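/- Let $V$ be a finite-dimensional real vector space with a symmetric bilinear form $B$, and let $\Delta$ be a basis of $V$ that is a simple system: $B(\alpha,\alpha)=1$ for all $\alpha\in\Delta$, and $B(\alpha,\beta)\in(-\infty,-1]\cup\{-\cos(\pi/k) : k\in\mathbb Z_{\ge 2}\}$ for all distinct $\alpha,\beta\in\Delta$. For $\alpha\in V$ with $B(\alpha,\alpha)\neq 0$ let $s_\alpha(v)=v-2\frac{B(\alpha,v)}{B(\alpha,\alpha)}\alpha$. Let $W$ be the group generated by the $s_\alpha$, $\alpha\in\Delta$, let $\Phi=W(\Delta)$ be the root system, and let $\Phi^+\subseteq\Phi$ be the set of positive roots, i.e. the roots that are nonnegative linear combinations of $\Delta$. Write $|v|_1$ for the sum of the coordinates of $v$ in the basis $\Delta$, put $\hat v=v/|v|_1$ when $|v|_1\ne0$ (which holds for every root), and $\hat A=\{\hat a : a\in A\}$ for $A\subseteq\Phi$. Let $\hat Q=\{v\in V : B(v,v)=0,\ |v|_1=1\}$. Let $E$ be the set of accumulation points of $\hat\Phi$ (the limit roots). For distinct $\rho_1,\rho_2\in\Phi^+$ let $W'=\langle s_{\rho_1},s_{\rho_2}\rangle$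 be the dihedral reflection subgroup they generate and $\Phi'=\{\rho\in\Phi : s_\rho\in W'\}$; the limit roots of $W'$ are the accumulation points of $\hat\Phi'$. Let $E_2$ be the union of the sets of limit roots of $W'$, over all infinite dihedral reflection subgroups $W'$ of this form. **Theorem.** Suppose that $\Phi$ is infinite. Then $$E_2=\bigcup_{\rho_1\ne\rho_2\in\Phi^+} L(\hat\rho_1,\hat\rho_2)\cap\hat Q,$$ where $L(\hat\rho_1,\hat\rho_2)$ is the line through $\hat\rho_1$ and $\hat\rho_2$. Moreover $E_2\subseteq E$ and $E_2$ is dense in $E$, so that $E$ is the closure of $E_2$. -/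

import Mathlib

namespace BasedRoot

noncomputable section

/-- The `B`-reflection associated to `α`,
`v ↦ v - 2 (B(α, v) / B(α, α)) α`. It is only meaningful when `B(α, α) ≠ 0`; with Lean's division by
zero it is the identity when `B(α, α) = 0`, hence always an involution. -/
def reflectionMap {V : Type*} [AddCommGroup V] [Module ℝ V]
    (B : LinearMap.BilinForm ℝ V) (α : V) : V →ₗ[ℝ] V :=
  LinearMap.id - (LinearMap.toSpanSingleton ℝ V α).comp ((2 / B α α) • B α)

theorem reflectionMap_apply {V : Type*} [AddCommGroup V] [Module ℝ V]
    (B : LinearMap.BilinForm ℝ V) (α v : V) :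
    reflectionMap B α v = v - (2 * (B α v / B α α)) • α := by
  simp only [reflectionMap, LinearMap.sub_apply, LinearMap.id_apply, LinearMap.comp_apply,
    LinearMap.smul_apply, LinearMap.toSpanSingleton_apply, smul_eq_mul]
  congr 2
  ring

theorem reflectionMap_involutive {V : Type*} [AddCommGroup V] [Module ℝ V]
    (B : LinearMap.BilinForm ℝ V) (α : V) : Function.Involutive (reflectionMap B α) := by
  intro v
  rcases eq_or_ne (B α α) 0 with h | h
  · simp [reflectionMap_apply, h]
  · simp only [reflectionMap_apply, map_sub, map_smul, div_self h]
    module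

/-- The `B`-reflection `s_α`, as an element of `GL(V)`. -/
def reflection {V : Type*} [AddCommGroup V] [Module ℝ V]
    (B : LinearMap.BilinForm ℝ V) (α : V) : V ≃ₗ[ℝ] V :=
  LinearEquiv.ofInvolutive (reflectionMap B α) (reflectionMap_involutive B α)

/-- The finite family `Δ` is a simple system in `(V, B)`. (Distinct indices automatically carry
distinct vectors, by `diag` and `off_diag`.) -/
structure IsSimpleSystem {ι V : Type*} [Fintype ι] [AddCommGroup V] [Module ℝ V]
    (B : LinearMap.BilinForm ℝ V) (Δ : ι → V) : Prop where
  symm : ∀ u v : V, B u v = B v u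
  pos_indep : ∀ c : ι → ℝ, (∀ i, 0 ≤ c i) → ∑ i, c i • Δ i = 0 → ∀ i, c i = 0
  off_diag : ∀ i j, i ≠ j →
    B (Δ i) (Δ j) ≤ -1 ∨ ∃ k : ℕ, 2 ≤ k ∧ B (Δ i) (Δ j) = -Real.cos (Real.pi / k)
  diag : ∀ i, B (Δ i) (Δ i) = 1

/-- The group `W` generated by the simple reflections. -/
def weylGroup {ι V : Type*} [AddCommGroup V] [Module ℝ V]
    (B : LinearMap.BilinForm ℝ V) (Δ : ι → V) : Subgroup (V ≃ₗ[ℝ] V) :=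
  Subgroup.closure (Set.range fun i => reflection B (Δ i))

/-- The root system `Φ`: the orbit of `Δ` under `W`. -/
def roots {ι V : Type*} [AddCommGroup V] [Module ℝ V]
    (B : LinearMap.BilinForm ℝ V) (Δ : ι → V) : Set V :=
  {v | ∃ w ∈ weylGroup B Δ, ∃ i, w (Δ i) = v}

/-- The cone of nonnegative linear combinations of `Δ`. -/
def cone {ι V : Type*} [Fintype ι] [AddCommGroup V] [Module ℝ V] (Δ : ι → V) : Set V :=
  {v | ∃ c : ι → ℝ, (∀ i, 0 ≤ c i) ∧ ∑ i, c i • Δ i = v}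

/-- The positive roots `Φ⁺ = Φ ∩ cone(Δ)`. -/
def posRoots {ι V : Type*} [Fintype ι] [AddCommGroup V] [Module ℝ V]
    (B : LinearMap.BilinForm ℝ V) (Δ : ι → V) : Set V :=
  roots B Δ ∩ cone Δ

/-- `|v|₁`, the sum of the coordinates of `v` in the basis `Δ` (not a norm). -/
def coordSum {ι V : Type*} [Fintype ι] [AddCommGroup V] [Module ℝ V]
    (Δ : Module.Basis ι ℝ V) (v : V) : ℝ :=
  ∑ i, Δ.repr v i

/-- The normalization `v̂ = v / |v|₁`, meaningful for `|v|₁ ≠ 0`, in particular for all roots. -/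
def normalizeVec {ι V : Type*} [Fintype ι] [AddCommGroup V] [Module ℝ V]
    (Δ : Module.Basis ι ℝ V) (v : V) : V :=
  (coordSum Δ v)⁻¹ • v

/-- The set of accumulation points of the normalizations of the elements of a set `A` of roots. -/
def limitSet {ι V : Type*} [Fintype ι] [NormedAddCommGroup V] [NormedSpace ℝ V]
    (Δ : Module.Basis ι ℝ V) (A : Set V) : Set V :=
  derivedSet (normalizeVec Δ '' A)

/-- The set `E` of limit roots. -/
def limitRoots {ι V : Type*} [Fintype ι] [NormedAddCommGroup V] [NormedSpace ℝ V]
    (B : LinearMap.BilinForm ℝ V) (Δ : Module.Basis ι ℝ V) : Set V :=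
  limitSet Δ (roots B Δ)

/-- The normalized isotropic cone `Q̂ = {v | B(v, v) = 0 and |v|₁ = 1}`. -/
def normalizedIsotropicCone {ι V : Type*} [Fintype ι] [AddCommGroup V] [Module ℝ V]
    (B : LinearMap.BilinForm ℝ V) (Δ : Module.Basis ι ℝ V) : Set V :=
  {v | B v v = 0 ∧ coordSum Δ v = 1}

/-- The subgroup generated by the two reflections `s_ρ₁`, `s_ρ₂`. -/
def dihedralSubgroup {V : Type*} [AddCommGroup V] [Module ℝ V]
    (B : LinearMap.BilinForm ℝ V) (ρ₁ ρ₂ : V) : Subgroup (V ≃ₗ[ℝ] V) :=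
  Subgroup.closure {reflection B ρ₁, reflection B ρ₂}

/-- The roots `Φ' = {ρ ∈ Φ | s_ρ ∈ W'}` of a subgroup `W'`. -/
def subsystem {ι V : Type*} [AddCommGroup V] [Module ℝ V]
    (B : LinearMap.BilinForm ℝ V) (Δ : ι → V) (W' : Subgroup (V ≃ₗ[ℝ] V)) : Set V :=
  {ρ | ρ ∈ roots B Δ ∧ reflection B ρ ∈ W'}

/-- The set `E₂`: the union, over all infinite dihedral reflection subgroups
`W' = ⟨s_ρ₁, s_ρ₂⟩` with `ρ₁ ≠ ρ₂` positive roots, of the limit roots of `W'`. -/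
def dihedralLimitRoots {ι V : Type*} [Fintype ι] [NormedAddCommGroup V] [NormedSpace ℝ V]
    (B : LinearMap.BilinForm ℝ V) (Δ : Module.Basis ι ℝ V) : Set V :=
  {x | ∃ ρ₁ ∈ posRoots B Δ, ∃ ρ₂ ∈ posRoots B Δ, ρ₁ ≠ ρ₂ ∧
    (dihedralSubgroup B ρ₁ ρ₂ : Set (V ≃ₗ[ℝ] V)).Infinite ∧
    x ∈ limitSet Δ (subsystem B Δ (dihedralSubgroup B ρ₁ ρ₂))}

/-- The union, over all pairs of distinct positive roots, of the intersection of `Q̂` with the line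
through the two normalized roots. -/
def isotropicLinePoints {ι V : Type*} [Fintype ι] [AddCommGroup V] [Module ℝ V]
    (B : LinearMap.BilinForm ℝ V) (Δ : Module.Basis ι ℝ V) : Set V :=
  {x | ∃ ρ₁ ∈ posRoots B Δ, ∃ ρ₂ ∈ posRoots B Δ, ρ₁ ≠ ρ₂ ∧
    x ∈ (affineSpan ℝ {normalizeVec Δ ρ₁, normalizeVec Δ ρ₂} : Set V) ∩ normalizedIsotropicCone B Δ}

end

end BasedRoot

/-!
The plane spanned by two distinct positive roots `ρ` and `σ` contains a nonzero isotropic vector if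
and only if `B ρ σ ^ 2 ≥ 1`. In that case `s_ρ s_σ` has infinite order, and the normalized roots of
the dihedral group accumulate only at isotropic points of the line through `ρ̂` and `σ̂`. The plane
has at most two isotropic lines, interchanged by `s_ρ`, so each of those points is a limit root.

For the density of these points, let `x` be a limit root; it is isotropic. If `B α x ≠ 0` for some
simple root `α`, then for `v` near `x` the line `v + ℝ α` meets the isotropic cone near `x`; take
for `v` the normalized roots close to `x`. Otherwise `x` is in the radical of `B`, and by the
Perron–Frobenius argument `B` is positive semidefinite on the span of the simple roots occurring in
`x`, which are orthogonal to the others. On the roots in this span `B` takes only finitely many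
values: a linear form vanishing at two of them and positive on the isotropic part of the cone can be
made dominant by a Weyl group element, which moves both roots into one of the finitely many finite
parabolic subsystems. So infinitely many of the roots near the ray of `x` define the same
functional `B ρ`, and their differences lie in the radical.
-/

namespace BasedRoot

section WordLength

variable {ι G : Type*} [Group G] {S : ι → G}

/-- The length of a shortest word in the letters `S i` with product `g`. Only positive words are
considered, so it is meaningful for families of involutions; it is `0` if there is no such word. -/
noncomputable def wordLength (S : ι → G) (g : G) : ℕ :=
  sInf {n | ∃ L : List ι, L.length = n ∧ (L.map S).prod = g}

theorem wordLength_prod_le (S : ι → G) (L : List ι) : wordLength S (L.map S).prod ≤ L.length :=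
  Nat.sInf_le ⟨L, rfl, rfl⟩

theorem exists_prod_eq_of_mem_closure (hS : ∀ i, S i * S i = 1) {g : G}
    (hg : g ∈ Subgroup.closure (Set.range S)) : ∃ L : List ι, (L.map S).prod = g := by
  induction hg using Subgroup.closure_induction_left with
  | one => exact ⟨[], rfl⟩
  | mul_left x hx y _ ih =>
    obtain ⟨⟨i, rfl⟩, L, rfl⟩ := And.intro hx ih
    exact ⟨i :: L, by simp⟩
  | inv_mul_cancel x hx y _ ih =>
    obtain ⟨⟨i, rfl⟩, L, rfl⟩ := And.intro hx ih
    exact ⟨i :: L, by simp [inv_eq_of_mul_eq_one_left (hS i)]⟩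

theorem exists_reduced_word (hS : ∀ i, S i * S i = 1) {g : G}
    (hg : g ∈ Subgroup.closure (Set.range S)) :
    ∃ L : List ι, L.length = wordLength S g ∧ (L.map S).prod = g := by
  obtain ⟨L, hL⟩ := exists_prod_eq_of_mem_closure hS hg
  exact Nat.sInf_mem (s := {n | ∃ L : List ι, L.length = n ∧ (L.map S).prod = g}) ⟨_, L, rfl, hL⟩

theorem wordLength_mul_le (hS : ∀ i, S i * S i = 1) {g h : G}
    (hg : g ∈ Subgroup.closure (Set.range S)) (hh : h ∈ Subgroup.closure (Set.range S)) :
    wordLength S (g * h) ≤ wordLength S g + wordLength S h := by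
  obtain ⟨L, hL, rfl⟩ := exists_reduced_word hS hg
  obtain ⟨M, hM, rfl⟩ := exists_reduced_word hS hh
  rw [← hL, ← hM, ← List.length_append, ← List.prod_append, ← List.map_append]
  exact wordLength_prod_le S (L ++ M)

theorem apply_mem_closure_range (S : ι → G) (i : ι) : S i ∈ Subgroup.closure (Set.range S) :=
  Subgroup.subset_closure ⟨i, rfl⟩

theorem wordLength_letter_mul_le (hS : ∀ i, S i * S i = 1) {g : G}
    (hg : g ∈ Subgroup.closure (Set.range S)) (i : ι) :
    wordLength S (S i * g) ≤ wordLength S g + 1 := by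
  have hi : wordLength S (S i) ≤ 1 := by simpa using wordLength_prod_le S [i]
  have := wordLength_mul_le hS (apply_mem_closure_range S i) hg
  omega

theorem exists_wordLength_mul_letter_lt (hS : ∀ i, S i * S i = 1) {g : G}
    (hg : g ∈ Subgroup.closure (Set.range S)) (hne : g ≠ 1) :
    ∃ i, wordLength S (g * S i) < wordLength S g := by
  obtain ⟨L, hL, rfl⟩ := exists_reduced_word hS hg
  rcases List.eq_nil_or_concat L with rfl | ⟨M, i, rfl⟩
  · exact absurd rfl hne
  · refine ⟨i, ?_⟩
    have hcancel : ((M.concat i).map S).prod * S i = (M.map S).prod := by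
      simp [mul_assoc, hS]
    rw [← hL, hcancel, List.length_concat]
    exact Nat.lt_succ_of_le (wordLength_prod_le S M)

/-- The letters of the alternating word `… s t s t`, counted from the right, starting at `0`. -/
def altLetter (s t : ι) (k : ℕ) : ι := if Even k then t else s

theorem altLetter_one (s t : ι) : altLetter s t 1 = s := rfl

theorem altLetter_add_two (s t : ι) (k : ℕ) : altLetter s t (k + 2) = altLetter s t k := by
  simp [altLetter, Nat.even_add]

theorem and_altLetter_iff (p : ι → Prop) {s t : ι} (k : ℕ) :
    p (altLetter s t k) ∧ p (altLetter s t (k + 1)) ↔ p s ∧ p t := by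
  by_cases hk : Even k <;> simp [altLetter, hk, Nat.even_add_one, and_comm]

/-- The product of the alternating word `… s t s t` of length `k`, ending in `t`. -/
def altProd (S : ι → G) (s t : ι) : ℕ → G
  | 0 => 1
  | k + 1 => S (altLetter s t k) * altProd S s t k

theorem altProd_succ (S : ι → G) (s t : ι) (k : ℕ) :
    altProd S s t (k + 1) = S (altLetter s t k) * altProd S s t k := rfl

theorem altProd_mem_closure (S : ι → G) (s t : ι) (k : ℕ) :
    altProd S s t k ∈ Subgroup.closure (Set.range S) := by
  induction k with
  | zero => exact one_mem _
  | succ k ih => exact mul_mem (apply_mem_closure_range S _) ih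

theorem wordLength_altProd_le (hS : ∀ i, S i * S i = 1) (s t : ι) (k : ℕ) :
    wordLength S (altProd S s t k) ≤ k := by
  induction k with
  | zero => exact wordLength_prod_le S []
  | succ k ih =>
    exact (wordLength_letter_mul_le hS (altProd_mem_closure S s t k) _).trans (by omega)

theorem wordLength_altProd_mul_letter_lt (hS : ∀ i, S i * S i = 1) {s t : ι} {m k : ℕ}
    (hm : altProd S s t (m + 1) * S s = altProd S s t m) (hk : m < k) :
    wordLength S (altProd S s t k * S s) < k := by
  induction k, hk using Nat.le_induction with
  | base =>
    rw [hm]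
    exact Nat.lt_succ_of_le (wordLength_altProd_le hS s t m)
  | succ k _ ih =>
    rw [altProd_succ, mul_assoc]
    have := wordLength_letter_mul_le hS
      (mul_mem (altProd_mem_closure S s t k) (apply_mem_closure_range S s)) (altLetter s t k)
    omega

/-- Take `v` shortest among all factorizations: if multiplying it by `s` or by `t` made it shorter,
this letter could be moved into the alternating factor, or cancelled against it. -/
theorem exists_eq_mul_altProd (hS : ∀ i, S i * S i = 1) {g : G}
    (hg : g ∈ Subgroup.closure (Set.range S)) {s t : ι}
    (hs : wordLength S g ≤ wordLength S (g * S s)) :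
    ∃ v ∈ Subgroup.closure (Set.range S), ∃ k, g = v * altProd S s t k ∧
      wordLength S v + k ≤ wordLength S g ∧
      wordLength S v ≤ wordLength S (v * S s) ∧ wordLength S v ≤ wordLength S (v * S t) := by
  let P : G → Prop := fun v => v ∈ Subgroup.closure (Set.range S) ∧
    ∃ k, g = v * altProd S s t k ∧ wordLength S v + k ≤ wordLength S g
  obtain ⟨v, hmin⟩ := exists_minimalFor_of_wellFoundedLT P (wordLength S)
    ⟨g, hg, 0, (mul_one g).symm, le_rfl⟩
  obtain ⟨hv, k, hgv, hlen⟩ := hmin.prop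
  refine ⟨v, hv, k, hgv, hlen, (and_altLetter_iff
    (fun r => wordLength S v ≤ wordLength S (v * S r)) k).1 ⟨?_, ?_⟩⟩ <;> by_contra! hlt
  · refine hlt.not_ge
      (hmin.le_of_le ⟨mul_mem hv (apply_mem_closure_range S _), k + 1, ?_, ?_⟩ hlt.le)
    · rw [altProd_succ, mul_assoc, ← mul_assoc (S _), hS, one_mul, hgv]
    · omega
  · cases k with
    | zero =>
      rw [altProd, mul_one] at hgv
      subst hgv
      exact hlt.not_ge hs
    | succ l =>
      rw [altLetter_add_two] at hlt
      have hglt : wordLength S g ≤ wordLength S (v * S (altLetter s t l)) + l :=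
        calc wordLength S g
            = wordLength S (v * S (altLetter s t l) * altProd S s t l) := by
              rw [hgv, altProd_succ, mul_assoc]
          _ ≤ _ + wordLength S (altProd S s t l) :=
              wordLength_mul_le hS (mul_mem hv (apply_mem_closure_range S _))
                (altProd_mem_closure S s t l)
          _ ≤ _ := by gcongr; exact wordLength_altProd_le hS s t l
      omega

end WordLength

section Chebyshev

open Polynomial Polynomial.Chebyshev

theorem chebyshevS_pred_add_one_le {x : ℝ} (hx : 2 ≤ x) (k : ℕ) :
    0 ≤ (S ℝ (k - 1)).eval x ∧ (S ℝ (k - 1)).eval x + 1 ≤ (S ℝ k).eval x := by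
  induction k with
  | zero => simp
  | succ k ih =>
    obtain ⟨h0, h1⟩ := ih
    have hS : (S ℝ (k + 1)).eval x = x * (S ℝ k).eval x - (S ℝ (k - 1)).eval x := by
      simp [S_add_one]
    push_cast
    rw [add_sub_cancel_right, hS]
    exact ⟨by linarith, by nlinarith⟩

theorem strictMono_chebyshevS_pred {x : ℝ} (hx : 2 ≤ x) :
    StrictMono fun k : ℕ => (S ℝ (k - 1)).eval x :=
  strictMono_nat_of_lt_succ fun k => by
    have := (chebyshevS_pred_add_one_le hx k).2
    push_cast
    rw [add_sub_cancel_right]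
    linarith

section CosPiDiv

variable {m : ℕ}

theorem sin_pi_div_pos (hm : 2 ≤ m) : 0 < Real.sin (Real.pi / m) := by
  have hm' : (1 : ℝ) < m := by exact_mod_cast hm
  exact Real.sin_pos_of_pos_of_lt_pi (by positivity) (div_lt_self Real.pi_pos hm')

theorem chebyshevS_two_cos_pi_div_pred (hm : 2 ≤ m) :
    (S ℝ (m - 1)).eval (2 * Real.cos (Real.pi / m)) = 0 := by
  have h := S_two_mul_real_cos (Real.pi / m) (m - 1)
  have hm0 : (m : ℝ) ≠ 0 := by positivity
  push_cast at h
  rw [sub_add_cancel, mul_div_cancel₀ _ hm0, Real.sin_pi] at h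
  exact (mul_eq_zero.1 h).resolve_right (sin_pi_div_pos hm).ne'

theorem chebyshevS_two_cos_pi_div_pred_pred (hm : 2 ≤ m) :
    (S ℝ (m - 2)).eval (2 * Real.cos (Real.pi / m)) = 1 := by
  have h := S_two_mul_real_cos (Real.pi / m) (m - 2)
  have hm0 : (m : ℝ) ≠ 0 := by positivity
  push_cast at h
  rw [show ((m : ℝ) - 2 + 1) * (Real.pi / m) = Real.pi - Real.pi / m by field_simp; ring,
    Real.sin_pi_sub] at h
  exact mul_right_cancel₀ (sin_pi_div_pos hm).ne' (h.trans (one_mul _).symm)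

theorem chebyshevS_two_cos_pi_div_nonneg (hm : 2 ≤ m) {n : ℤ} (h0 : -1 ≤ n) (hn : n < m) :
    0 ≤ (S ℝ n).eval (2 * Real.cos (Real.pi / m)) := by
  have h0' : (0 : ℝ) ≤ n + 1 := by exact_mod_cast (by omega : (0 : ℤ) ≤ n + 1)
  have hn' : (n : ℝ) + 1 ≤ m := by exact_mod_cast hn
  have hm0 : (m : ℝ) ≠ 0 := by positivity
  refine nonneg_of_mul_nonneg_left ?_ (sin_pi_div_pos hm)
  rw [S_two_mul_real_cos]
  refine Real.sin_nonneg_of_nonneg_of_le_pi (by positivity) ?_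
  calc ((n : ℝ) + 1) * (Real.pi / m) ≤ m * (Real.pi / m) := by gcongr
    _ = Real.pi := mul_div_cancel₀ _ hm0

end CosPiDiv

end Chebyshev

section Reflection

variable {V : Type*} [AddCommGroup V] [Module ℝ V] {B : LinearMap.BilinForm ℝ V} {α : V}

theorem reflection_apply (h : B α α = 1) (v : V) :
    reflection B α v = v - (2 * B α v) • α := by
  rw [← div_one (B α v), ← h]
  exact reflectionMap_apply B α v

theorem reflection_mul_self (α : V) : reflection B α * reflection B α = 1 :=
  LinearEquiv.ext (reflectionMap_involutive B α)

theorem reflection_reflection (α v : V) : reflection B α (reflection B α v) = v :=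
  reflectionMap_involutive B α v

theorem reflection_self (h : B α α = 1) : reflection B α α = -α := by
  rw [reflection_apply h, h]
  module

theorem reflection_isometry (hB : B.IsSymm) (h : B α α = 1) (u v : V) :
    B (reflection B α u) (reflection B α v) = B u v := by
  simp only [reflection_apply h, map_sub, map_smul, LinearMap.sub_apply,
    LinearMap.smul_apply, smul_eq_mul, h, hB.eq u α]
  ring

theorem reflection_apply_of_isometry {w : V ≃ₗ[ℝ] V} (hw : ∀ u v, B (w u) (w v) = B u v)
    (h : B α α = 1) : reflection B (w α) = w * reflection B α * w⁻¹ := by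
  ext v
  obtain ⟨u, rfl⟩ := w.surjective v
  have hinv : w⁻¹ (w u) = u := w.symm_apply_apply u
  rw [LinearEquiv.mul_apply, LinearEquiv.mul_apply, hinv, reflection_apply ((hw α α).trans h),
    reflection_apply h, hw, map_sub, map_smul]

theorem sub_mem_span_of_mem_closure_reflection {A : Set V} {w : V ≃ₗ[ℝ] V}
    (hw : w ∈ Subgroup.closure (reflection B '' A)) (v : V) :
    w v - v ∈ Submodule.span ℝ A := by
  induction hw using Subgroup.closure_induction generalizing v with
  | mem w hw =>
    obtain ⟨α, hα, rfl⟩ := hw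
    change reflectionMap B α v - v ∈ _
    rw [reflectionMap_apply, sub_sub_cancel_left]
    exact neg_mem (Submodule.smul_mem _ _ (Submodule.subset_span hα))
  | one => simp
  | mul w w' _ _ hw hw' =>
    have := add_mem (hw (w' v)) (hw' v)
    rwa [sub_add_sub_cancel] at this
  | inv w _ hw =>
    have := neg_mem (hw (w⁻¹ v))
    rw [neg_sub] at this
    rwa [show w (w⁻¹ v) = v from w.apply_symm_apply v] at this

theorem apply_eq_self_of_mem_closure_reflection {A : Set V} {v : V} (hv : ∀ α ∈ A, B α v = 0)
    {w : V ≃ₗ[ℝ] V} (hw : w ∈ Subgroup.closure (reflection B '' A)) : w v = v := by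
  refine (Subgroup.closure_le (MulAction.stabilizer (V ≃ₗ[ℝ] V) v)).2 ?_ hw
  rintro _ ⟨α, hα, rfl⟩
  change reflectionMap B α v = v
  rw [reflectionMap_apply, hv α hα, zero_div, mul_zero, zero_smul, sub_zero]

end Reflection

section WeylGroup

variable {ι V : Type*} [AddCommGroup V] [Module ℝ V] {B : LinearMap.BilinForm ℝ V} {Δ : ι → V}

/-- The reflection in the simple root `Δ i`, as a function of the index `i`. -/
noncomputable abbrev simpleReflection (B : LinearMap.BilinForm ℝ V) (Δ : ι → V) (i : ι) :
    V ≃ₗ[ℝ] V :=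
  reflection B (Δ i)

theorem simpleReflection_mul_self (i : ι) :
    simpleReflection B Δ i * simpleReflection B Δ i = 1 :=
  reflection_mul_self (Δ i)

theorem simpleReflection_mem_weylGroup (i : ι) : simpleReflection B Δ i ∈ weylGroup B Δ :=
  Subgroup.subset_closure ⟨i, rfl⟩

theorem simple_mem_roots (i : ι) : Δ i ∈ roots B Δ := ⟨1, one_mem _, i, rfl⟩

theorem apply_mem_roots {w : V ≃ₗ[ℝ] V} (hw : w ∈ weylGroup B Δ) {ρ : V}
    (hρ : ρ ∈ roots B Δ) : w ρ ∈ roots B Δ := by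
  obtain ⟨w', hw', i, rfl⟩ := hρ
  exact ⟨w * w', mul_mem hw hw', i, rfl⟩

variable [Fintype ι]

theorem IsSimpleSystem.isSymm (hΔ : IsSimpleSystem B Δ) : B.IsSymm := ⟨hΔ.symm⟩

theorem weylGroup_isometry (hΔ : IsSimpleSystem B Δ) {w : V ≃ₗ[ℝ] V}
    (hw : w ∈ weylGroup B Δ) (u v : V) : B (w u) (w v) = B u v := by
  induction hw using Subgroup.closure_induction generalizing u v with
  | mem x hx =>
    obtain ⟨i, rfl⟩ := hx
    exact reflection_isometry hΔ.isSymm (hΔ.diag i) u v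
  | one => rfl
  | mul x y _ _ hx hy => rw [LinearEquiv.mul_apply, LinearEquiv.mul_apply, hx, hy]
  | inv x _ hx =>
    rw [← hx]
    exact congrArg₂ (fun a b => B a b) (x.apply_symm_apply u) (x.apply_symm_apply v)

theorem bilin_root_self (hΔ : IsSimpleSystem B Δ) {ρ : V} (hρ : ρ ∈ roots B Δ) :
    B ρ ρ = 1 := by
  obtain ⟨w, hw, i, rfl⟩ := hρ
  rw [weylGroup_isometry hΔ hw, hΔ.diag]

theorem reflection_mem_weylGroup (hΔ : IsSimpleSystem B Δ) {ρ : V}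
    (hρ : ρ ∈ roots B Δ) : reflection B ρ ∈ weylGroup B Δ := by
  obtain ⟨w, hw, i, rfl⟩ := hρ
  rw [reflection_apply_of_isometry (weylGroup_isometry hΔ hw) (hΔ.diag i)]
  exact mul_mem (mul_mem hw (simpleReflection_mem_weylGroup i)) (inv_mem hw)

open Polynomial Polynomial.Chebyshev

theorem altProd_simpleReflection_apply (hΔ : IsSimpleSystem B Δ) (s t : ι) (k : ℕ) :
    altProd (simpleReflection B Δ) s t k (Δ s) =
      (S ℝ k).eval (-2 * B (Δ s) (Δ t)) • Δ (altLetter s t (k + 1)) +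
        (S ℝ (k - 1)).eval (-2 * B (Δ s) (Δ t)) • Δ (altLetter s t k) := by
  induction k with
  | zero => simp [altProd, altLetter_one]
  | succ k ih =>
    have hst : B (Δ (altLetter s t k)) (Δ (altLetter s t (k + 1))) = B (Δ s) (Δ t) := by
      by_cases hk : Even k <;> simp [altLetter, hk, Nat.even_add_one, hΔ.symm (Δ t) (Δ s)]
    rw [altProd_succ, LinearEquiv.mul_apply, ih, reflection_apply (hΔ.diag _), altLetter_add_two,
      map_add, map_smul, map_smul, hst, hΔ.diag]
    push_cast
    rw [add_sub_cancel_right, S_add_one, eval_sub, eval_mul, eval_X]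
    module

theorem altProd_mul_letter (hΔ : IsSimpleSystem B Δ) {s t : ι} {m : ℕ}
    (hm : 2 ≤ m) (hst : B (Δ s) (Δ t) = -Real.cos (Real.pi / m)) :
    altProd (simpleReflection B Δ) s t m * simpleReflection B Δ s =
      altProd (simpleReflection B Δ) s t (m - 1) := by
  obtain ⟨l, rfl⟩ : ∃ l, m = l + 1 := ⟨m - 1, by omega⟩
  set a := altProd (simpleReflection B Δ) s t l with ha
  have hmap : a (Δ s) = Δ (altLetter s t l) := by
    have h0 := chebyshevS_two_cos_pi_div_pred hm
    have h1 := chebyshevS_two_cos_pi_div_pred_pred hm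
    push_cast at h0 h1
    rw [add_sub_cancel_right] at h0
    rw [add_sub_assoc, show (1 : ℤ) - 2 = -1 by norm_num, ← sub_eq_add_neg] at h1
    rw [ha, altProd_simpleReflection_apply hΔ, hst]
    push_cast
    rw [neg_mul_neg, h0, h1, zero_smul, zero_add, one_smul]
  have hconj : simpleReflection B Δ (altLetter s t l) = a * simpleReflection B Δ s * a⁻¹ := by
    rw [simpleReflection, ← hmap]
    exact reflection_apply_of_isometry
      (weylGroup_isometry hΔ (altProd_mem_closure (simpleReflection B Δ) s t l)) (hΔ.diag s)
  rw [altProd_succ, hconj, ← ha, inv_mul_cancel_right, mul_assoc, simpleReflection_mul_self,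
    mul_one, Nat.add_sub_cancel]

end WeylGroup

section Positivity

variable {ι V : Type*} [Fintype ι] [AddCommGroup V] [Module ℝ V]
  {B : LinearMap.BilinForm ℝ V}

section Cone

variable {Δ : ι → V}

theorem simple_mem_cone (i : ι) : Δ i ∈ cone Δ := by
  classical
  have hnonneg : (0 : ι → ℝ) ≤ Pi.single i 1 := Pi.single_nonneg.2 zero_le_one
  exact ⟨Pi.single i 1, hnonneg, by simp [Pi.single_apply]⟩

theorem add_mem_cone {u v : V} (hu : u ∈ cone Δ) (hv : v ∈ cone Δ) : u + v ∈ cone Δ := by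
  obtain ⟨⟨c, hc, rfl⟩, d, hd, rfl⟩ := And.intro hu hv
  exact ⟨c + d, fun i => add_nonneg (hc i) (hd i), by
    simp only [Pi.add_apply, add_smul, Finset.sum_add_distrib]⟩

theorem smul_mem_cone {a : ℝ} (ha : 0 ≤ a) {v : V} (hv : v ∈ cone Δ) : a • v ∈ cone Δ := by
  obtain ⟨c, hc, rfl⟩ := hv
  exact ⟨a • c, fun i => mul_nonneg ha (hc i), by
    simp only [Pi.smul_apply, smul_assoc, Finset.smul_sum]⟩

theorem eq_zero_of_mem_cone_of_neg_mem_cone (hΔ : IsSimpleSystem B Δ) {v : V} (h : v ∈ cone Δ)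
    (h' : -v ∈ cone Δ) : v = 0 := by
  obtain ⟨⟨c, hc, rfl⟩, d, hd, hcd⟩ := And.intro h h'
  have hsum : ∑ i, (c i + d i) • Δ i = 0 := by
    simp only [add_smul, Finset.sum_add_distrib, hcd, add_neg_cancel]
  have hzero := hΔ.pos_indep _ (fun i => add_nonneg (hc i) (hd i)) hsum
  refine Finset.sum_eq_zero fun i _ => ?_
  rw [show c i = 0 by linarith [hzero i, hc i, hd i], zero_smul]

end Cone

section SimpleSystem

variable {Δ : ι → V}

open Polynomial Polynomial.Chebyshev

theorem chebyshevS_bilin_nonneg (hΔ : IsSimpleSystem B Δ) {w v : V ≃ₗ[ℝ] V}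
    (hv : v ∈ weylGroup B Δ) {s t : ι} (hst : s ≠ t) {k : ℕ}
    (hw : w = v * altProd (simpleReflection B Δ) s t k)
    (hlen : wordLength (simpleReflection B Δ) v + k ≤ wordLength (simpleReflection B Δ) w)
    (hs : wordLength (simpleReflection B Δ) w ≤
      wordLength (simpleReflection B Δ) (w * simpleReflection B Δ s)) :
    0 ≤ (S ℝ k).eval (-2 * B (Δ s) (Δ t)) ∧ 0 ≤ (S ℝ (k - 1)).eval (-2 * B (Δ s) (Δ t)) := by
  rcases hΔ.off_diag s t hst with hle | ⟨m, hm, hcos⟩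
  · obtain ⟨h0, h1⟩ :=
      chebyshevS_pred_add_one_le (x := -2 * B (Δ s) (Δ t)) (by linarith) k
    exact ⟨by linarith, h0⟩
  · have hkm : k < m := by
      by_contra! hmk
      obtain ⟨l, rfl⟩ : ∃ l, m = l + 1 := ⟨m - 1, by omega⟩
      have h1 := wordLength_altProd_mul_letter_lt simpleReflection_mul_self
        (altProd_mul_letter hΔ hm hcos) hmk
      have h2 := wordLength_mul_le simpleReflection_mul_self hv
        (mul_mem (altProd_mem_closure (simpleReflection B Δ) s t k)
          (simpleReflection_mem_weylGroup s))
      rw [← mul_assoc, ← hw] at h2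
      omega
    rw [hcos, neg_mul_neg]
    exact ⟨chebyshevS_two_cos_pi_div_nonneg hm (by omega) (by omega),
      chebyshevS_two_cos_pi_div_nonneg hm (by omega) (by omega)⟩

/-- Split off from the right of `w` the longest possible alternating word in `s` and a letter `t`
that shortens `w`. By induction the remaining factor maps `Δ s` and `Δ t` into the cone. -/
theorem apply_simple_mem_cone_of_wordLength_le (hΔ : IsSimpleSystem B Δ) {w : V ≃ₗ[ℝ] V}
    (hw : w ∈ weylGroup B Δ) {s : ι}
    (hs : wordLength (simpleReflection B Δ) w ≤
      wordLength (simpleReflection B Δ) (w * simpleReflection B Δ s)) :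
    w (Δ s) ∈ cone Δ := by
  induction hn : wordLength (simpleReflection B Δ) w using Nat.strong_induction_on
    generalizing w s with
  | _ n ih =>
  subst hn
  rcases eq_or_ne w 1 with rfl | hne
  · exact simple_mem_cone s
  obtain ⟨t, ht⟩ := exists_wordLength_mul_letter_lt simpleReflection_mul_self hw hne
  have hst : s ≠ t := by
    rintro rfl
    exact ht.not_ge hs
  obtain ⟨v, hv, k, hwv, hlen, hvs, hvt⟩ :=
    exists_eq_mul_altProd (t := t) simpleReflection_mul_self hw hs
  have hk : k ≠ 0 := by
    rintro rfl
    rw [altProd, mul_one] at hwv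
    exact ht.not_ge (hwv ▸ hvt)
  obtain ⟨hvr, hvr'⟩ := (and_altLetter_iff (fun r => v (Δ r) ∈ cone Δ) k).2
    ⟨ih _ (by omega) hv hvs rfl, ih _ (by omega) hv hvt rfl⟩
  obtain ⟨hS, hS'⟩ := chebyshevS_bilin_nonneg hΔ hv hst hwv hlen hs
  rw [hwv, LinearEquiv.mul_apply, altProd_simpleReflection_apply hΔ, map_add, map_smul, map_smul]
  exact add_mem_cone (smul_mem_cone hS hvr') (smul_mem_cone hS' hvr)

theorem neg_apply_simple_mem_cone_of_wordLength_lt (hΔ : IsSimpleSystem B Δ) {w : V ≃ₗ[ℝ] V}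
    (hw : w ∈ weylGroup B Δ) {s : ι}
    (hs : wordLength (simpleReflection B Δ) (w * simpleReflection B Δ s) <
      wordLength (simpleReflection B Δ) w) :
    -w (Δ s) ∈ cone Δ := by
  have h := apply_simple_mem_cone_of_wordLength_le hΔ
    (mul_mem hw (simpleReflection_mem_weylGroup s)) (s := s)
    (by rw [mul_assoc, simpleReflection_mul_self, mul_one]; exact hs.le)
  rwa [LinearEquiv.mul_apply, reflection_self (hΔ.diag s), map_neg] at h

theorem root_ne_zero (hΔ : IsSimpleSystem B Δ) {ρ : V} (hρ : ρ ∈ roots B Δ) : ρ ≠ 0 := by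
  rintro rfl
  simpa using bilin_root_self hΔ hρ

theorem neg_mem_roots (hΔ : IsSimpleSystem B Δ) {ρ : V} (hρ : ρ ∈ roots B Δ) :
    -ρ ∈ roots B Δ := by
  rw [← reflection_self (bilin_root_self hΔ hρ)]
  exact apply_mem_roots (reflection_mem_weylGroup hΔ hρ) hρ

theorem mem_or_neg_mem_posRoots (hΔ : IsSimpleSystem B Δ) {ρ : V} (hρ : ρ ∈ roots B Δ) :
    ρ ∈ posRoots B Δ ∨ -ρ ∈ posRoots B Δ := by
  have hneg := neg_mem_roots hΔ hρ
  obtain ⟨w, hw, i, rfl⟩ := id hρ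
  rcases le_or_gt (wordLength (simpleReflection B Δ) w)
    (wordLength (simpleReflection B Δ) (w * simpleReflection B Δ i)) with h | h
  · exact Or.inl ⟨hρ, apply_simple_mem_cone_of_wordLength_le hΔ hw h⟩
  · exact Or.inr ⟨hneg, neg_apply_simple_mem_cone_of_wordLength_lt hΔ hw h⟩

theorem simple_mem_posRoots (i : ι) : Δ i ∈ posRoots B Δ :=
  ⟨simple_mem_roots i, simple_mem_cone i⟩

theorem eq_one_of_forall_apply_simple_mem_cone (hΔ : IsSimpleSystem B Δ) {w : V ≃ₗ[ℝ] V}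
    (hw : w ∈ weylGroup B Δ) (h : ∀ i, w (Δ i) ∈ cone Δ) : w = 1 := by
  by_contra hne
  obtain ⟨i, hi⟩ := exists_wordLength_mul_letter_lt simpleReflection_mul_self hw hne
  exact root_ne_zero hΔ (apply_mem_roots hw (simple_mem_roots i))
    (eq_zero_of_mem_cone_of_neg_mem_cone hΔ (h i)
      (neg_apply_simple_mem_cone_of_wordLength_lt hΔ hw hi))

theorem eq_or_eq_neg_of_eq_smul (hΔ : IsSimpleSystem B Δ) {ρ σ : V} (hρ : ρ ∈ roots B Δ)
    (hσ : σ ∈ roots B Δ) {c : ℝ} (h : ρ = c • σ) : ρ = σ ∨ ρ = -σ := by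
  have hc : c * c = 1 := by
    have hρρ := bilin_root_self hΔ hρ
    rw [h, map_smul, map_smul, LinearMap.smul_apply, bilin_root_self hΔ hσ] at hρρ
    linear_combination hρρ
  rcases mul_self_eq_one_iff.1 hc with rfl | rfl
  · exact Or.inl (h.trans (one_smul ℝ σ))
  · exact Or.inr (h.trans (neg_one_smul ℝ σ))

theorem eq_of_eq_smul_of_mem_posRoots (hΔ : IsSimpleSystem B Δ) {ρ σ : V} (hρ : ρ ∈ posRoots B Δ)
    (hσ : σ ∈ posRoots B Δ) {c : ℝ} (h : ρ = c • σ) : ρ = σ :=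
  (eq_or_eq_neg_of_eq_smul hΔ hρ.1 hσ.1 h).resolve_right fun hneg =>
    root_ne_zero hΔ hσ.1 (eq_zero_of_mem_cone_of_neg_mem_cone hΔ hσ.2 (hneg ▸ hρ.2))

theorem injOn_reflection_posRoots (hΔ : IsSimpleSystem B Δ) :
    Set.InjOn (reflection B) (posRoots B Δ) := by
  intro ρ hρ σ hσ h
  refine eq_of_eq_smul_of_mem_posRoots hΔ hρ hσ (c := B σ ρ) ?_
  have hρ' := reflection_self (bilin_root_self hΔ hρ.1)
  rw [h, reflection_apply (bilin_root_self hΔ hσ.1)] at hρ'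
  linear_combination (norm := module) (1 / 2 : ℝ) • hρ'

end SimpleSystem

section Basis

variable {Δ : Module.Basis ι ℝ V}

theorem mem_cone_iff {v : V} : v ∈ cone Δ ↔ ∀ j, 0 ≤ Δ.repr v j := by
  constructor
  · rintro ⟨c, hc, rfl⟩ j
    rw [Δ.repr_sum_self]
    exact hc j
  · exact fun h => ⟨Δ.repr v, h, Δ.sum_repr v⟩

theorem sumCoords_apply (v : V) : Δ.sumCoords v = ∑ i, Δ.repr v i := by
  simp

theorem coordSum_eq_sumCoords (v : V) : coordSum Δ v = Δ.sumCoords v := (sumCoords_apply v).symm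

theorem sumCoords_nonneg_of_mem_cone {v : V} (h : v ∈ cone Δ) : 0 ≤ Δ.sumCoords v := by
  rw [sumCoords_apply]
  exact Finset.sum_nonneg fun i _ => mem_cone_iff.1 h i

theorem repr_le_sumCoords {v : V} (h : v ∈ cone Δ) (i : ι) : Δ.repr v i ≤ Δ.sumCoords v := by
  rw [sumCoords_apply]
  exact Finset.single_le_sum (fun j _ => mem_cone_iff.1 h j) (Finset.mem_univ i)

theorem eq_zero_of_sumCoords_eq_zero {v : V} (h : v ∈ cone Δ) (h0 : Δ.sumCoords v = 0) : v = 0 :=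
  Δ.ext_elem fun i => by
    rw [map_zero, Finsupp.zero_apply]
    exact le_antisymm (h0 ▸ repr_le_sumCoords h i) (mem_cone_iff.1 h i)

theorem sumCoords_pos (hΔ : IsSimpleSystem B Δ) {ρ : V} (hρ : ρ ∈ posRoots B Δ) :
    0 < Δ.sumCoords ρ :=
  (sumCoords_nonneg_of_mem_cone hρ.2).lt_of_ne fun h =>
    root_ne_zero hΔ hρ.1 (eq_zero_of_sumCoords_eq_zero hρ.2 h.symm)

theorem mem_posRoots_iff_sumCoords_pos (hΔ : IsSimpleSystem B Δ) {ρ : V} (hρ : ρ ∈ roots B Δ) :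
    ρ ∈ posRoots B Δ ↔ 0 < Δ.sumCoords ρ := by
  refine ⟨sumCoords_pos hΔ, fun h => (mem_or_neg_mem_posRoots hΔ hρ).resolve_right fun h' => ?_⟩
  have := sumCoords_pos hΔ h'
  rw [map_neg] at this
  linarith

theorem sumCoords_ne_zero (hΔ : IsSimpleSystem B Δ) {ρ : V} (hρ : ρ ∈ roots B Δ) :
    Δ.sumCoords ρ ≠ 0 := by
  rcases mem_or_neg_mem_posRoots hΔ hρ with h | h
  · exact (sumCoords_pos hΔ h).ne'
  · simpa using (sumCoords_pos hΔ h).ne'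

theorem repr_simpleReflection_of_ne (hΔ : IsSimpleSystem B Δ) {i j : ι} (h : j ≠ i) (v : V) :
    Δ.repr (simpleReflection B Δ i v) j = Δ.repr v j := by
  simp [reflection_apply (hΔ.diag i), h.symm]

theorem simpleReflection_mem_posRoots (hΔ : IsSimpleSystem B Δ) {i : ι} {ρ : V}
    (hρ : ρ ∈ posRoots B Δ) (hne : ρ ≠ Δ i) : simpleReflection B Δ i ρ ∈ posRoots B Δ := by
  have hroot := apply_mem_roots (simpleReflection_mem_weylGroup i) hρ.1
  refine (mem_or_neg_mem_posRoots hΔ hroot).resolve_right fun hneg => hne ?_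
  refine eq_of_eq_smul_of_mem_posRoots hΔ hρ (simple_mem_posRoots i) (c := Δ.repr ρ i) ?_
  refine Δ.ext_elem fun j => ?_
  rcases eq_or_ne j i with rfl | hj
  · simp
  · have h := mem_cone_iff.1 hneg.2 j
    rw [map_neg, Finsupp.neg_apply, repr_simpleReflection_of_ne hΔ hj] at h
    simpa [hj.symm] using le_antisymm (neg_nonneg.1 h) (mem_cone_iff.1 hρ.2 j)

end Basis

end Positivity

section Normalization

variable {ι V : Type*} [Fintype ι] [AddCommGroup V] [Module ℝ V]
  {B : LinearMap.BilinForm ℝ V} {Δ : Module.Basis ι ℝ V}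

theorem normalizeVec_eq_smul (v : V) : normalizeVec Δ v = (Δ.sumCoords v)⁻¹ • v := by
  rw [normalizeVec, coordSum_eq_sumCoords]

theorem sumCoords_normalizeVec {v : V} (h : Δ.sumCoords v ≠ 0) :
    Δ.sumCoords (normalizeVec Δ v) = 1 := by
  rw [normalizeVec_eq_smul, map_smul, smul_eq_mul, inv_mul_cancel₀ h]

theorem normalizeVec_smul {c : ℝ} (hc : c ≠ 0) (v : V) :
    normalizeVec Δ (c • v) = normalizeVec Δ v := by
  rw [normalizeVec_eq_smul, normalizeVec_eq_smul, map_smul, smul_smul, smul_eq_mul, mul_inv,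
    mul_right_comm, inv_mul_cancel₀ hc, one_mul]

theorem normalizeVec_neg (v : V) : normalizeVec Δ (-v) = normalizeVec Δ v := by
  rw [← neg_one_smul ℝ v, normalizeVec_smul (by norm_num)]

theorem bilin_normalizeVec_self (hΔ : IsSimpleSystem B Δ) {ρ : V} (hρ : ρ ∈ roots B Δ) :
    B (normalizeVec Δ ρ) (normalizeVec Δ ρ) = ((Δ.sumCoords ρ)⁻¹) ^ 2 := by
  rw [normalizeVec_eq_smul, map_smul, map_smul, LinearMap.smul_apply, bilin_root_self hΔ hρ,
    smul_eq_mul, smul_eq_mul]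
  ring

theorem eq_or_eq_neg_of_normalizeVec_eq (hΔ : IsSimpleSystem B Δ) {ρ σ : V}
    (hρ : ρ ∈ roots B Δ) (hσ : σ ∈ roots B Δ) (h : normalizeVec Δ ρ = normalizeVec Δ σ) :
    ρ = σ ∨ ρ = -σ := by
  refine eq_or_eq_neg_of_eq_smul hΔ hρ hσ (c := Δ.sumCoords ρ * (Δ.sumCoords σ)⁻¹) ?_
  rw [normalizeVec_eq_smul, normalizeVec_eq_smul] at h
  rw [mul_smul, ← h, smul_inv_smul₀ (sumCoords_ne_zero hΔ hρ)]

theorem image_normalizeVec_posRoots (hΔ : IsSimpleSystem B Δ) :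
    normalizeVec Δ '' posRoots B Δ = normalizeVec Δ '' roots B Δ := by
  refine (Set.image_mono Set.inter_subset_left).antisymm ?_
  rintro _ ⟨ρ, hρ, rfl⟩
  rcases mem_or_neg_mem_posRoots hΔ hρ with h | h
  · exact ⟨ρ, h, rfl⟩
  · exact ⟨-ρ, h, normalizeVec_neg ρ⟩

theorem mem_affineSpan_normalizeVec_iff {ρ σ x : V} (hρ : Δ.sumCoords ρ ≠ 0)
    (hσ : Δ.sumCoords σ ≠ 0) :
    x ∈ (affineSpan ℝ {normalizeVec Δ ρ, normalizeVec Δ σ} : Set V) ↔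
      x ∈ Submodule.span ℝ {ρ, σ} ∧ Δ.sumCoords x = 1 := by
  rw [SetLike.mem_coe, mem_affineSpan_pair_iff_exists_lineMap_eq, Submodule.mem_span_pair]
  constructor
  · rintro ⟨r, rfl⟩
    rw [AffineMap.lineMap_apply_module]
    refine ⟨⟨(1 - r) * (Δ.sumCoords ρ)⁻¹, r * (Δ.sumCoords σ)⁻¹, ?_⟩, ?_⟩
    · rw [normalizeVec_eq_smul, normalizeVec_eq_smul, smul_smul, smul_smul]
    · rw [map_add, map_smul, map_smul, sumCoords_normalizeVec hρ, sumCoords_normalizeVec hσ,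
        smul_eq_mul, smul_eq_mul]
      ring
  · rintro ⟨⟨a, b, rfl⟩, h⟩
    rw [map_add, map_smul, map_smul, smul_eq_mul, smul_eq_mul] at h
    refine ⟨b * Δ.sumCoords σ, ?_⟩
    rw [AffineMap.lineMap_apply_module, ← h, normalizeVec_eq_smul, normalizeVec_eq_smul, smul_smul,
      smul_smul, add_sub_cancel_right, mul_inv_cancel_right₀ hρ, mul_inv_cancel_right₀ hσ]

theorem normalizeVec_add_smul_mem_isotropicLinePoints (hΔ : IsSimpleSystem B Δ) {ρ η : V}
    (hρ : ρ ∈ posRoots B Δ) (hη : η ∈ posRoots B Δ) (hne : ρ ≠ η) {a : ℝ}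
    (hB : B (normalizeVec Δ ρ + a • η) (normalizeVec Δ ρ + a • η) = 0)
    (hsum : Δ.sumCoords (normalizeVec Δ ρ + a • η) ≠ 0) :
    normalizeVec Δ (normalizeVec Δ ρ + a • η) ∈ isotropicLinePoints B Δ := by
  refine ⟨ρ, hρ, η, hη, hne, (mem_affineSpan_normalizeVec_iff (sumCoords_pos hΔ hρ).ne'
    (sumCoords_pos hΔ hη).ne').2 ⟨?_, sumCoords_normalizeVec hsum⟩, ?_, ?_⟩
  · rw [normalizeVec_eq_smul (_ + _), normalizeVec_eq_smul]
    exact Submodule.smul_mem _ _ (Submodule.mem_span_pair.2 ⟨_, _, rfl⟩)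
  · rw [normalizeVec_eq_smul (_ + _), map_smul, map_smul, LinearMap.smul_apply, hB, smul_zero,
      smul_zero]
  · rw [coordSum_eq_sumCoords, sumCoords_normalizeVec hsum]

end Normalization

section Limits

open Filter Topology

section Continuity

variable {V : Type*} [NormedAddCommGroup V] [NormedSpace ℝ V] [FiniteDimensional ℝ V]

theorem continuous_bilin (B : LinearMap.BilinForm ℝ V) : Continuous fun p : V × V => B p.1 p.2 :=
  (LinearMap.toContinuousBilinearMap B).continuous₂

theorem continuous_bilin_self (B : LinearMap.BilinForm ℝ V) : Continuous fun v : V => B v v :=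
  (continuous_bilin B).comp (continuous_id.prodMk continuous_id)

theorem continuousAt_reflection {B : LinearMap.BilinForm ℝ V} {X : Type*} [TopologicalSpace X]
    {f g : X → V} {x : X} (hf : ContinuousAt f x) (hg : ContinuousAt g x)
    (h : B (f x) (f x) ≠ 0) : ContinuousAt (fun y => reflection B (f y) (g y)) x := by
  have hquot : ContinuousAt (fun y => B (f y) (g y) / B (f y) (f y)) x :=
    ((continuous_bilin B).continuousAt.comp (hf.prodMk hg)).div
      ((continuous_bilin B).continuousAt.comp (hf.prodMk hf)) h
  exact (hg.sub ((hquot.const_mul 2).smul hf)).congr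
    (Eventually.of_forall fun y => (reflectionMap_apply B (f y) (g y)).symm)

theorem continuous_sumCoords {ι : Type*} (Δ : Module.Basis ι ℝ V) : Continuous Δ.sumCoords :=
  Δ.sumCoords.continuous_of_finiteDimensional

end Continuity

variable {ι V : Type*} [Fintype ι] [NormedAddCommGroup V] [NormedSpace ℝ V]
  {B : LinearMap.BilinForm ℝ V} {Δ : Module.Basis ι ℝ V}

theorem isCompact_cone_sumCoords_le (Δ : Module.Basis ι ℝ V) (C : ℝ) :
    IsCompact {v | v ∈ cone Δ ∧ Δ.sumCoords v ≤ C} := by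
  have : FiniteDimensional ℝ V := Module.Finite.of_basis Δ
  have hcoords : IsCompact (Set.Icc (0 : ι → ℝ) (fun _ => C) ∩ {c | ∑ i, c i ≤ C}) :=
    isCompact_Icc.inter_right (isClosed_le (by fun_prop) continuous_const)
  convert Δ.equivFun.toContinuousLinearEquiv.toHomeomorph.isCompact_preimage.2 hcoords using 1
  ext v
  have hbound (h : v ∈ cone Δ) (hC : Δ.sumCoords v ≤ C) : Δ.equivFun v ≤ fun _ => C := fun i =>
    (repr_le_sumCoords h i).trans hC
  have hcone : v ∈ cone Δ ↔ 0 ≤ Δ.equivFun v := mem_cone_iff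
  have hsum : Δ.sumCoords v = ∑ i, Δ.equivFun v i := sumCoords_apply v
  simp only [Set.mem_ofPred_eq, Set.mem_preimage, Set.mem_inter_iff, Set.mem_Icc]
  change _ ↔ (0 ≤ Δ.equivFun v ∧ (Δ.equivFun v ≤ fun _ => C)) ∧ ∑ i, Δ.equivFun v i ≤ C
  rw [← hcone, ← hsum]
  exact ⟨fun h => ⟨⟨h.1, hbound h.1 h.2⟩, h.2⟩, fun h => ⟨h.1.1, h.2⟩⟩

/-- For `ρ` and `σ` close to `x`, the product `s_ρ s_σ` is close to the identity, so it maps every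
simple root to a positive root. -/
theorem exists_nhds_subsingleton_inter_posRoots (hΔ : IsSimpleSystem B Δ) {x : V}
    (hx : B x x = 1) : ∃ N ∈ 𝓝 x, (N ∩ posRoots B Δ).Subsingleton := by
  have : FiniteDimensional ℝ V := Module.Finite.of_basis Δ
  have hx0 : B x x ≠ 0 := hx ▸ one_ne_zero
  have hcont (i : ι) : ContinuousAt
      (fun p : V × V => Δ.sumCoords (reflection B p.1 (reflection B p.2 (Δ i)))) (x, x) := by
    have hinner : ContinuousAt (fun p : V × V => reflection B p.2 (Δ i)) (x, x) :=
      continuousAt_reflection continuousAt_snd continuousAt_const hx0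
    exact (continuous_sumCoords Δ).continuousAt.comp
      (continuousAt_reflection continuousAt_fst hinner hx0)
  have hpos : ∀ᶠ p in 𝓝 (x, x), ∀ i,
      0 < Δ.sumCoords (reflection B p.1 (reflection B p.2 (Δ i))) :=
    eventually_all.2 fun i => (hcont i).eventually_const_lt (by
      change 0 < Δ.sumCoords (reflection B x (reflection B x (Δ i)))
      rw [reflection_reflection, Δ.sumCoords_self_apply]
      exact one_pos)
  rw [nhds_prod_eq] at hpos
  obtain ⟨N, hN, hNpos⟩ := (eventually_prod_self_iff (r := fun ρ σ => ∀ i,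
    0 < Δ.sumCoords (reflection B ρ (reflection B σ (Δ i))))).1 hpos
  refine ⟨N, hN, fun ρ hρ σ hσ => injOn_reflection_posRoots hΔ hρ.2 hσ.2 ?_⟩
  have hw : reflection B ρ * reflection B σ ∈ weylGroup B Δ :=
    mul_mem (reflection_mem_weylGroup hΔ hρ.2.1) (reflection_mem_weylGroup hΔ hσ.2.1)
  have hone : reflection B ρ * reflection B σ = 1 :=
    eq_one_of_forall_apply_simple_mem_cone hΔ hw fun i =>
      ((mem_posRoots_iff_sumCoords_pos hΔ (apply_mem_roots hw (simple_mem_roots i))).2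
        (hNpos ρ hρ.1 σ hσ.1 i)).2
  exact mul_right_cancel (hone.trans (reflection_mul_self σ).symm)

theorem finite_posRoots_sumCoords_le (hΔ : IsSimpleSystem B Δ) (C : ℝ) :
    {ρ | ρ ∈ posRoots B Δ ∧ Δ.sumCoords ρ ≤ C}.Finite := by
  have : FiniteDimensional ℝ V := Module.Finite.of_basis Δ
  by_contra hinf
  obtain ⟨x, -, hx⟩ := Set.Infinite.exists_accPt_of_subset_isCompact hinf
    (isCompact_cone_sumCoords_le Δ C) fun ρ hρ => ⟨hρ.1.2, hρ.2⟩
  have hBx : B x x = 1 :=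
    closure_minimal (t := {v | B v v = 1}) (fun ρ hρ => bilin_root_self hΔ hρ.1.1)
      (isClosed_eq (continuous_bilin_self B) continuous_const) (derivedSet_subset_closure _ hx)
  obtain ⟨N, hN, hsub⟩ := exists_nhds_subsingleton_inter_posRoots hΔ hBx
  exact Set.Infinite.of_accPt (hx.nhds_inter hN)
    (hsub.finite.subset fun ρ hρ => ⟨hρ.1, hρ.2.1⟩)

theorem limitSet_posRoots (hΔ : IsSimpleSystem B Δ) :
    limitSet Δ (posRoots B Δ) = limitRoots B Δ := by
  rw [limitRoots, limitSet, limitSet, image_normalizeVec_posRoots hΔ]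

theorem limitSet_mono {A A' : Set V} (h : A ⊆ A') : limitSet Δ A ⊆ limitSet Δ A' :=
  derivedSet_mono _ _ (Set.image_mono h)

theorem sumCoords_eq_one_of_mem_limitRoots (hΔ : IsSimpleSystem B Δ) {x : V}
    (hx : x ∈ limitRoots B Δ) : Δ.sumCoords x = 1 := by
  have : FiniteDimensional ℝ V := Module.Finite.of_basis Δ
  refine closure_minimal (t := {v | Δ.sumCoords v = 1}) ?_
    (isClosed_eq (continuous_sumCoords Δ) continuous_const) (derivedSet_subset_closure _ hx)
  rintro _ ⟨ρ, hρ, rfl⟩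
  exact sumCoords_normalizeVec (sumCoords_ne_zero hΔ hρ)

theorem finite_image_normalizeVec_inter_lt_bilin (hΔ : IsSimpleSystem B Δ) {ε : ℝ} (hε : 0 < ε) :
    (normalizeVec Δ '' roots B Δ ∩ {v | ε < B v v}).Finite := by
  rw [← image_normalizeVec_posRoots hΔ]
  refine ((finite_posRoots_sumCoords_le hΔ √ε⁻¹).image (normalizeVec Δ)).subset ?_
  rintro _ ⟨⟨ρ, hρ, rfl⟩, hlt : ε < _⟩
  have hpos := sumCoords_pos hΔ hρ
  rw [bilin_normalizeVec_self hΔ hρ.1, inv_pow] at hlt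
  refine ⟨ρ, ⟨hρ, Real.le_sqrt_of_sq_le ?_⟩, rfl⟩
  exact ((lt_inv_comm₀ hε (by positivity)).1 hlt).le

theorem limitRoots_subset_normalizedIsotropicCone (hΔ : IsSimpleSystem B Δ) :
    limitRoots B Δ ⊆ normalizedIsotropicCone B Δ := by
  have : FiniteDimensional ℝ V := Module.Finite.of_basis Δ
  intro x hx
  refine ⟨?_, by rw [coordSum_eq_sumCoords, sumCoords_eq_one_of_mem_limitRoots hΔ hx]⟩
  have hcont := continuous_bilin_self B
  have hnonneg : 0 ≤ B x x := by
    refine closure_minimal (t := {v | 0 ≤ B v v}) ?_ (isClosed_le continuous_const hcont)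
      (derivedSet_subset_closure _ hx)
    rintro _ ⟨ρ, hρ, rfl⟩
    change 0 ≤ B _ _
    rw [bilin_normalizeVec_self hΔ hρ]
    exact sq_nonneg _
  by_contra hne
  have hpos : 0 < B x x := hnonneg.lt_of_ne' hne
  have hU : {v | B x x / 2 < B v v} ∈ 𝓝 x :=
    hcont.continuousAt.eventually_const_lt (half_lt_self hpos)
  refine Set.Infinite.of_accPt (AccPt.nhds_inter hx hU) ?_
  rw [Set.inter_comm]
  exact finite_image_normalizeVec_inter_lt_bilin hΔ (half_pos hpos)

theorem limitSet_nonempty (hΔ : IsSimpleSystem B Δ) {A : Set V} (hA : A ⊆ roots B Δ)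
    (hinf : A.Infinite) : (limitSet Δ A).Nonempty := by
  have hinf' : (normalizeVec Δ '' A).Infinite := by
    refine fun hfin => hinf (Set.Finite.of_finite_fibers (normalizeVec Δ) hfin ?_)
    rintro _ ⟨σ, hσ, rfl⟩
    exact (Set.toFinite {σ, -σ}).subset fun ρ hρ =>
      eq_or_eq_neg_of_normalizeVec_eq hΔ (hA hρ.1) (hA hσ) hρ.2
  have hsub : normalizeVec Δ '' A ⊆ {v | v ∈ cone Δ ∧ Δ.sumCoords v ≤ 1} := by
    intro v hv
    obtain ⟨ρ, hρ, rfl⟩ := (image_normalizeVec_posRoots hΔ).ge (Set.image_mono hA hv)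
    have hpos := sumCoords_pos hΔ hρ
    refine ⟨?_, (sumCoords_normalizeVec hpos.ne').le⟩
    exact normalizeVec_eq_smul (Δ := Δ) ρ ▸ smul_mem_cone (inv_nonneg.2 hpos.le) hρ.2
  obtain ⟨x, -, hx⟩ := hinf'.exists_accPt_of_subset_isCompact (isCompact_cone_sumCoords_le Δ 1) hsub
  exact ⟨x, hx⟩

end Limits

section DihedralSubgroup

open Polynomial.Chebyshev

section Plane

variable {V : Type*} [AddCommGroup V] [Module ℝ V] {B : LinearMap.BilinForm ℝ V} {ρ σ : V}

theorem rotation_pow_apply_self (hB : B.IsSymm) (hρ : B ρ ρ = 1) (hσ : B σ σ = 1) (n : ℕ) :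
    ((reflection B ρ * reflection B σ) ^ n) ρ =
      ((S ℝ n).eval (4 * B ρ σ ^ 2 - 2) + (S ℝ (n - 1)).eval (4 * B ρ σ ^ 2 - 2)) • ρ -
        (2 * B ρ σ * (S ℝ (n - 1)).eval (4 * B ρ σ ^ 2 - 2)) • σ := by
  have key (α : V) (h : B α α = 1) : ∃ h' : ((2 : ℝ) • B α) α = 2,
      reflection B α = Module.reflection h' := by
    refine ⟨by simp [h], LinearEquiv.ext fun v => ?_⟩
    rw [reflection_apply h, Module.reflection_apply, LinearMap.smul_apply, smul_eq_mul]
  obtain ⟨hρ', hρeq⟩ := key ρ hρ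
  obtain ⟨hσ', hσeq⟩ := key σ hσ
  have ht : ((2 : ℝ) • B ρ) σ * ((2 : ℝ) • B σ) ρ - 2 = 4 * B ρ σ ^ 2 - 2 := by
    simp only [LinearMap.smul_apply, smul_eq_mul, hB.eq σ ρ]
    ring
  rw [hρeq, hσeq, Module.reflection_mul_reflection_pow_apply_self hρ' hσ' n _ ht.symm]
  simp only [LinearMap.smul_apply, smul_eq_mul, hB.eq σ ρ]
  module

theorem bilin_smul_add_smul_self (hB : B.IsSymm) (hρ : B ρ ρ = 1) (hσ : B σ σ = 1) (a b : ℝ) :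
    B (a • ρ + b • σ) (a • ρ + b • σ) = a ^ 2 + 2 * a * b * B ρ σ + b ^ 2 := by
  simp only [map_add, map_smul, LinearMap.add_apply, LinearMap.smul_apply, smul_eq_mul, hρ, hσ,
    hB.eq σ ρ]
  ring

theorem right_coeff_ne_zero_of_isotropic (hρ : B ρ ρ = 1) {a b : ℝ}
    (h : B (a • ρ + b • σ) (a • ρ + b • σ) = 0) (h0 : a • ρ + b • σ ≠ 0) : b ≠ 0 := by
  rintro rfl
  have ha : a = 0 := by simpa [hρ] using h
  exact h0 (by rw [ha, zero_smul, zero_smul, add_zero])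

theorem one_le_sq_bilin_of_isotropic (hB : B.IsSymm) (hρ : B ρ ρ = 1) (hσ : B σ σ = 1) {u : V}
    (hu : u ∈ Submodule.span ℝ {ρ, σ}) (hBu : B u u = 0) (hu0 : u ≠ 0) : 1 ≤ B ρ σ ^ 2 := by
  obtain ⟨a, b, rfl⟩ := Submodule.mem_span_pair.1 hu
  have hb := right_coeff_ne_zero_of_isotropic hρ hBu hu0
  rw [bilin_smul_add_smul_self hB hρ hσ] at hBu
  by_contra! hlt
  have hpos : 0 < b ^ 2 := by positivity
  nlinarith [sq_nonneg (a + b * B ρ σ)]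

/-- The two isotropic lines of the plane spanned by `ρ` and `σ` correspond to the roots of
`t ^ 2 + 2 * B ρ σ * t + 1`, and `s_ρ` maps the line of `t` to that of `-2 * B ρ σ - t`. -/
theorem eq_smul_or_eq_smul_reflection_of_isotropic (hB : B.IsSymm) (hρ : B ρ ρ = 1)
    (hσ : B σ σ = 1) {u z : V} (hu : u ∈ Submodule.span ℝ {ρ, σ}) (hBu : B u u = 0)
    (hz : z ∈ Submodule.span ℝ {ρ, σ}) (hBz : B z z = 0) (hz0 : z ≠ 0) :
    ∃ c : ℝ, u = c • z ∨ u = c • reflection B ρ z := by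
  obtain ⟨a, b, rfl⟩ := Submodule.mem_span_pair.1 hu
  obtain ⟨p, q, rfl⟩ := Submodule.mem_span_pair.1 hz
  have hq := right_coeff_ne_zero_of_isotropic hρ hBz hz0
  rw [bilin_smul_add_smul_self hB hρ hσ] at hBu hBz
  have hfactor : (a * q - b * p) * (a * q + b * p + 2 * b * q * B ρ σ) = 0 := by
    linear_combination q ^ 2 * hBu - b ^ 2 * hBz
  refine ⟨b / q, (mul_eq_zero.1 hfactor).imp (fun h => ?_) fun h => ?_⟩
  · have ha : a = b / q * p := by
      field_simp
      linear_combination h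
    rw [smul_add, smul_smul, smul_smul, ← ha, div_mul_cancel₀ b hq]
  · have ha : a = b / q * (-p - 2 * q * B ρ σ) := by
      field_simp
      linear_combination h
    rw [map_add, map_smul, map_smul, reflection_self hρ, reflection_apply hρ, ha]
    nth_rw 2 [← div_mul_cancel₀ b hq]
    module

theorem sub_mem_span_of_mem_dihedralSubgroup {w : V ≃ₗ[ℝ] V} (hw : w ∈ dihedralSubgroup B ρ σ)
    (v : V) : w v - v ∈ Submodule.span ℝ {ρ, σ} := by
  rw [dihedralSubgroup, ← Set.image_pair] at hw
  exact sub_mem_span_of_mem_closure_reflection hw v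

theorem reflection_mul_reflection_mem_dihedralSubgroup (ρ σ : V) :
    reflection B ρ * reflection B σ ∈ dihedralSubgroup B ρ σ :=
  mul_mem (Subgroup.subset_closure (Or.inl rfl)) (Subgroup.subset_closure (Or.inr rfl))

end Plane

section Subsystem

variable {ι V : Type*} [AddCommGroup V] [Module ℝ V] {B : LinearMap.BilinForm ℝ V} {Δ : ι → V}
  {ρ σ : V}

theorem subsystem_subset_roots (W' : Subgroup (V ≃ₗ[ℝ] V)) : subsystem B Δ W' ⊆ roots B Δ :=
  fun _ h => h.1

variable [Fintype ι]

theorem subsystem_dihedralSubgroup_subset_span (hΔ : IsSimpleSystem B Δ) (ρ σ : V) :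
    subsystem B Δ (dihedralSubgroup B ρ σ) ⊆ Submodule.span ℝ {ρ, σ} := by
  rintro τ ⟨hτ, hw⟩
  have h := Submodule.smul_mem _ (-(1 / 2) : ℝ) (sub_mem_span_of_mem_dihedralSubgroup hw τ)
  rw [reflection_self (bilin_root_self hΔ hτ)] at h
  rwa [show (-(1 / 2) : ℝ) • (-τ - τ) = τ by module] at h

theorem apply_mem_subsystem (hΔ : IsSimpleSystem B Δ) {W' : Subgroup (V ≃ₗ[ℝ] V)}
    {w : V ≃ₗ[ℝ] V} (hw : w ∈ weylGroup B Δ) (hw' : w ∈ W') {τ : V}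
    (hτ : τ ∈ subsystem B Δ W') : w τ ∈ subsystem B Δ W' := by
  refine ⟨apply_mem_roots hw hτ.1, ?_⟩
  rw [reflection_apply_of_isometry (weylGroup_isometry hΔ hw) (bilin_root_self hΔ hτ.1)]
  exact mul_mem (mul_mem hw' hτ.2) (inv_mem hw')

theorem linearIndependent_pair_posRoots (hΔ : IsSimpleSystem B Δ) (hρ : ρ ∈ posRoots B Δ)
    (hσ : σ ∈ posRoots B Δ) (hne : ρ ≠ σ) : LinearIndependent ℝ ![ρ, σ] :=
  (LinearIndependent.pair_iff' (root_ne_zero hΔ hρ.1)).2 fun _ h =>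
    hne (eq_of_eq_smul_of_mem_posRoots hΔ hσ hρ h.symm).symm

theorem injective_rotation_pow_apply_self (hΔ : IsSimpleSystem B Δ) (hρ : ρ ∈ posRoots B Δ)
    (hσ : σ ∈ posRoots B Δ) (hne : ρ ≠ σ) (hc : 1 ≤ B ρ σ ^ 2) :
    Function.Injective fun n : ℕ => ((reflection B ρ * reflection B σ) ^ n) ρ := by
  intro n m h
  simp only [rotation_pow_apply_self hΔ.isSymm (bilin_root_self hΔ hρ.1)
    (bilin_root_self hΔ hσ.1)] at h
  set t := 4 * B ρ σ ^ 2 - 2 with t_def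
  simp only [sub_eq_add_neg _ (_ • σ), ← neg_smul] at h
  have hcoeff := ((linearIndependent_pair_posRoots hΔ hρ hσ hne).eq_of_pair h).2
  have hρσ : 2 * B ρ σ ≠ 0 := mul_ne_zero two_ne_zero fun h0 => by norm_num [h0] at hc
  have ht : 2 ≤ t := by linarith only [hc, t_def]
  exact (strictMono_chebyshevS_pred ht).injective (mul_left_cancel₀ hρσ (neg_injective hcoeff))

theorem infinite_dihedralSubgroup (hΔ : IsSimpleSystem B Δ) (hρ : ρ ∈ posRoots B Δ)
    (hσ : σ ∈ posRoots B Δ) (hne : ρ ≠ σ) (hc : 1 ≤ B ρ σ ^ 2) :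
    (dihedralSubgroup B ρ σ : Set (V ≃ₗ[ℝ] V)).Infinite := by
  have hinj : Function.Injective fun n : ℕ => (reflection B ρ * reflection B σ) ^ n := fun _ _ h =>
    injective_rotation_pow_apply_self hΔ hρ hσ hne hc (congrArg (fun w : V ≃ₗ[ℝ] V => w ρ) h)
  exact Set.infinite_of_injective_forall_mem hinj fun n =>
    pow_mem (reflection_mul_reflection_mem_dihedralSubgroup ρ σ) n

theorem infinite_subsystem_dihedralSubgroup (hΔ : IsSimpleSystem B Δ) (hρ : ρ ∈ posRoots B Δ)
    (hσ : σ ∈ posRoots B Δ) (hne : ρ ≠ σ) (hc : 1 ≤ B ρ σ ^ 2) :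
    (subsystem B Δ (dihedralSubgroup B ρ σ)).Infinite :=
  Set.infinite_of_injective_forall_mem (injective_rotation_pow_apply_self hΔ hρ hσ hne hc)
    fun n => apply_mem_subsystem hΔ
      (pow_mem (mul_mem (reflection_mem_weylGroup hΔ hρ.1) (reflection_mem_weylGroup hΔ hσ.1)) n)
      (pow_mem (reflection_mul_reflection_mem_dihedralSubgroup ρ σ) n)
      ⟨hρ.1, Subgroup.subset_closure (Or.inl rfl)⟩

end Subsystem

section LimitRoots

open Filter Topology

variable {ι V : Type*} [Fintype ι] [NormedAddCommGroup V] [NormedSpace ℝ V]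
  {B : LinearMap.BilinForm ℝ V} {Δ : Module.Basis ι ℝ V} {ρ σ : V}

theorem limitSet_subsystem_subset_span (hΔ : IsSimpleSystem B Δ) (ρ σ : V) :
    limitSet Δ (subsystem B Δ (dihedralSubgroup B ρ σ)) ⊆ Submodule.span ℝ {ρ, σ} := by
  have : FiniteDimensional ℝ V := Module.Finite.of_basis Δ
  refine (derivedSet_subset_closure _).trans (closure_minimal ?_
    (Submodule.closed_of_finiteDimensional _))
  rintro _ ⟨τ, hτ, rfl⟩
  rw [normalizeVec_eq_smul]
  exact Submodule.smul_mem _ _ (subsystem_dihedralSubgroup_subset_span hΔ ρ σ hτ)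

theorem normalizeVec_apply_mem_limitSet (hΔ : IsSimpleSystem B Δ) {A : Set V}
    (hA : A ⊆ roots B Δ) {w : V ≃ₗ[ℝ] V} (hw : w ∈ weylGroup B Δ) (hwA : ∀ τ ∈ A, w τ ∈ A) {z : V}
    (hz : z ∈ limitSet Δ A) (h0 : Δ.sumCoords (w z) ≠ 0) :
    normalizeVec Δ (w z) ∈ limitSet Δ A := by
  have : FiniteDimensional ℝ V := Module.Finite.of_basis Δ
  have hcont : Tendsto (fun v => normalizeVec Δ (w v)) (𝓝 z) (𝓝 (normalizeVec Δ (w z))) := by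
    simp only [normalizeVec_eq_smul]
    have hw : ContinuousAt w z := w.toLinearMap.continuous_of_finiteDimensional.continuousAt
    exact (((continuous_sumCoords Δ).continuousAt.comp hw).inv₀ h0).smul hw
  have hBz : B (normalizeVec Δ (w z)) (normalizeVec Δ (w z)) = 0 := by
    rw [normalizeVec_eq_smul, map_smul, map_smul, LinearMap.smul_apply, weylGroup_isometry hΔ hw,
      (limitRoots_subset_normalizedIsotropicCone hΔ (limitSet_mono hA hz)).1, smul_zero, smul_zero]
  refine accPt_iff_frequently.2 (hcont.frequently ((accPt_iff_frequently.1 hz).mono ?_))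
  rintro _ ⟨-, τ, hτ, rfl⟩
  have hwτ : normalizeVec Δ (w (normalizeVec Δ τ)) = normalizeVec Δ (w τ) := by
    rw [normalizeVec_eq_smul τ, map_smul,
      normalizeVec_smul (inv_ne_zero (sumCoords_ne_zero hΔ (hA hτ)))]
  refine ⟨fun heq => ?_, w τ, hwA τ hτ, hwτ.symm⟩
  have hroot := hA (hwA τ hτ)
  rw [← heq, hwτ, bilin_normalizeVec_self hΔ hroot] at hBz
  exact pow_ne_zero 2 (inv_ne_zero (sumCoords_ne_zero hΔ hroot)) hBz

/-- A limit root of the dihedral group lies on one of the two isotropic lines of the plane spanned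
by `ρ` and `σ`, and applying `s_ρ` to it gives the other one. -/
theorem mem_limitSet_subsystem_of_isotropic (hΔ : IsSimpleSystem B Δ) (hρ : ρ ∈ posRoots B Δ)
    (hσ : σ ∈ posRoots B Δ) (hne : ρ ≠ σ) {x : V} (hx : x ∈ Submodule.span ℝ {ρ, σ})
    (hBx : B x x = 0) (hx1 : Δ.sumCoords x = 1) :
    x ∈ limitSet Δ (subsystem B Δ (dihedralSubgroup B ρ σ)) := by
  have hρρ := bilin_root_self hΔ hρ.1
  have hσσ := bilin_root_self hΔ hσ.1
  have ne_zero {v : V} (hv : Δ.sumCoords v = 1) : v ≠ 0 := by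
    rintro rfl
    simp at hv
  have hc := one_le_sq_bilin_of_isotropic hΔ.isSymm hρρ hσσ hx hBx (ne_zero hx1)
  obtain ⟨z, hz⟩ := limitSet_nonempty hΔ (subsystem_subset_roots _)
    (infinite_subsystem_dihedralSubgroup hΔ hρ hσ hne hc)
  have hzlimit := limitSet_mono (subsystem_subset_roots _) hz
  have hz1 := sumCoords_eq_one_of_mem_limitRoots hΔ hzlimit
  obtain ⟨c, rfl | rfl⟩ := eq_smul_or_eq_smul_reflection_of_isotropic hΔ.isSymm hρρ hσσ hx hBx
    (limitSet_subsystem_subset_span hΔ ρ σ hz)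
    (limitRoots_subset_normalizedIsotropicCone hΔ hzlimit).1 (ne_zero hz1)
  · rw [map_smul, hz1, smul_eq_mul, mul_one] at hx1
    rwa [hx1, one_smul]
  · rw [map_smul, smul_eq_mul] at hx1
    rw [eq_inv_of_mul_eq_one_left hx1, ← normalizeVec_eq_smul]
    have hsρ : reflection B ρ ∈ dihedralSubgroup B ρ σ := Subgroup.subset_closure (Or.inl rfl)
    have hwρ := reflection_mem_weylGroup hΔ hρ.1
    exact normalizeVec_apply_mem_limitSet hΔ (subsystem_subset_roots _) hwρ
      (fun τ hτ => apply_mem_subsystem hΔ hwρ hsρ hτ) hz (right_ne_zero_of_mul_eq_one hx1)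

theorem dihedralLimitRoots_eq_isotropicLinePoints (hΔ : IsSimpleSystem B Δ) :
    dihedralLimitRoots B Δ = isotropicLinePoints B Δ := by
  have hne {ρ : V} (hρ : ρ ∈ posRoots B Δ) := (sumCoords_pos hΔ hρ).ne'
  ext x
  constructor
  · rintro ⟨ρ, hρ, σ, hσ, hρσ, -, hx⟩
    have hlimit := limitSet_mono (subsystem_subset_roots _) hx
    exact ⟨ρ, hρ, σ, hσ, hρσ, (mem_affineSpan_normalizeVec_iff (hne hρ) (hne hσ)).2
      ⟨limitSet_subsystem_subset_span hΔ ρ σ hx, sumCoords_eq_one_of_mem_limitRoots hΔ hlimit⟩,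
      limitRoots_subset_normalizedIsotropicCone hΔ hlimit⟩
  · rintro ⟨ρ, hρ, σ, hσ, hρσ, hline, hBx, -⟩
    obtain ⟨hspan, hx1⟩ := (mem_affineSpan_normalizeVec_iff (hne hρ) (hne hσ)).1 hline
    have hx := mem_limitSet_subsystem_of_isotropic hΔ hρ hσ hρσ hspan hBx hx1
    have hx0 : x ≠ 0 := by
      rintro rfl
      simp at hx1
    have hc := one_le_sq_bilin_of_isotropic hΔ.isSymm (bilin_root_self hΔ hρ.1)
      (bilin_root_self hΔ hσ.1) hspan hBx hx0
    exact ⟨ρ, hρ, σ, hσ, hρσ, infinite_dihedralSubgroup hΔ hρ hσ hρσ hc, hx⟩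

theorem dihedralLimitRoots_subset_limitRoots : dihedralLimitRoots B Δ ⊆ limitRoots B Δ := by
  rintro x ⟨ρ, -, σ, -, -, -, hx⟩
  exact limitSet_mono (subsystem_subset_roots _) hx

end LimitRoots

end DihedralSubgroup

section SemidefiniteComponent

section LinearAlgebra

variable {ι V : Type*} [AddCommGroup V] [Module ℝ V] {B : LinearMap.BilinForm ℝ V}

theorem exists_mem_span_pair_bilin_eq (hB : B.IsSymm) {ρ σ : V} (hρ : B ρ ρ = 1)
    (hσ : B σ σ = 1) (h : B ρ σ ^ 2 ≠ 1) (a b : ℝ) :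
    ∃ p ∈ Submodule.span ℝ {ρ, σ}, B p ρ = a ∧ B p σ = b := by
  have hdet : 1 - B ρ σ ^ 2 ≠ 0 := sub_ne_zero.2 h.symm
  refine ⟨((a - b * B ρ σ) / (1 - B ρ σ ^ 2)) • ρ + ((b - a * B ρ σ) / (1 - B ρ σ ^ 2)) • σ,
    Submodule.mem_span_pair.2 ⟨_, _, rfl⟩, ?_, ?_⟩ <;>
  · simp only [map_add, map_smul, LinearMap.add_apply, LinearMap.smul_apply, smul_eq_mul, hρ, hσ,
      hB.eq σ ρ]
    field_simp
    ring

theorem sq_bilin_le_of_nonneg (hB : B.IsSymm) {U : Submodule ℝ V} (hU : ∀ v ∈ U, 0 ≤ B v v)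
    {u v : V} (hu : u ∈ U) (hv : v ∈ U) : B u v ^ 2 ≤ B u u * B v v :=
  LinearMap.BilinForm.apply_sq_le_of_symm (B.restrict U) (fun w => hU w w.2)
    ⟨fun _ _ => hB.eq _ _⟩ ⟨u, hu⟩ ⟨v, hv⟩

theorem bilin_eq_zero_of_isotropic (hB : B.IsSymm) {U : Submodule ℝ V}
    (hU : ∀ v ∈ U, 0 ≤ B v v) {u r : V} (hu : u ∈ U) (hr : r ∈ U) (h : B r r = 0) :
    B u r = 0 := by
  have hsq := sq_bilin_le_of_nonneg hB hU hu hr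
  rw [h, mul_zero] at hsq
  exact pow_eq_zero_iff two_ne_zero |>.1 (le_antisymm hsq (sq_nonneg _))

theorem bilin_sum_smul_self_of_forall_bilin_sum_eq_zero [Fintype ι] (hB : B.IsSymm) {e : ι → V}
    (he : ∀ i, B (e i) (∑ j, e j) = 0) (d : ι → ℝ) :
    B (∑ i, d i • e i) (∑ i, d i • e i) =
      -(1 / 2) * ∑ i, ∑ j, (d i - d j) ^ 2 * B (e i) (e j) := by
  have hrow : ∑ i, ∑ j, d i ^ 2 * B (e i) (e j) = 0 :=
    Finset.sum_eq_zero fun i _ => by rw [← Finset.mul_sum, ← map_sum, he, mul_zero]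
  have hcol : ∑ i, ∑ j, d j ^ 2 * B (e i) (e j) = 0 := by
    rw [Finset.sum_comm, ← hrow]
    simp only [hB.eq]
  have hexpand : ∑ i, ∑ j, (d i - d j) ^ 2 * B (e i) (e j) =
      ∑ i, ∑ j, d i ^ 2 * B (e i) (e j) + ∑ i, ∑ j, d j ^ 2 * B (e i) (e j) -
        2 * ∑ i, ∑ j, d i * d j * B (e i) (e j) := by
    simp only [Finset.mul_sum, ← Finset.sum_add_distrib, ← Finset.sum_sub_distrib]
    exact Finset.sum_congr rfl fun i _ => Finset.sum_congr rfl fun j _ => by ring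
  rw [hexpand, hrow, hcol]
  simp only [map_sum, map_smul, LinearMap.sum_apply, LinearMap.smul_apply, smul_eq_mul, mul_assoc,
    Finset.mul_sum]
  rw [Finset.sum_comm]
  simp only [zero_add, zero_sub, Finset.mul_sum, mul_neg, ← Finset.sum_neg_distrib]
  exact Finset.sum_congr rfl fun i _ => Finset.sum_congr rfl fun j _ => by ring

theorem bilin_simple_eq_zero_of_mem_span (hB : B.IsSymm) {Δ : ι → V} {J : Set ι}
    (hJ : ∀ i ∈ J, ∀ j ∉ J, B (Δ i) (Δ j) = 0) {j : ι} (hj : j ∉ J) {v : V}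
    (hv : v ∈ Submodule.span ℝ (Δ '' J)) : B (Δ j) v = 0 := by
  refine LinearMap.mem_ker.1 (Submodule.span_le.2 ?_ hv)
  rintro _ ⟨i, hi, rfl⟩
  exact LinearMap.mem_ker.2 ((hB.eq _ _).trans (hJ i hi j hj))

theorem mem_span_simple_iff {Δ : Module.Basis ι ℝ V} {J : Set ι} {v : V} :
    v ∈ Submodule.span ℝ (Δ '' J) ↔ ∀ i ∉ J, Δ.repr v i = 0 := by
  rw [Δ.mem_span_image]
  exact forall_congr' fun i => by
    rw [Finset.mem_coe, Finsupp.mem_support_iff, not_imp_comm]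

/-- `J` is a union of connected components of the Coxeter graph on whose span `B` is positive
semidefinite. The support of a nonnegative vector in the radical of `B` has this property. -/
structure IsSemidefiniteComponent (B : LinearMap.BilinForm ℝ V) (Δ : ι → V) (J : Set ι) :
    Prop where
  orthogonal : ∀ i ∈ J, ∀ j ∉ J, B (Δ i) (Δ j) = 0
  nonneg : ∀ v ∈ Submodule.span ℝ (Δ '' J), 0 ≤ B v v

end LinearAlgebra

variable {ι V : Type*} [Fintype ι] [AddCommGroup V] [Module ℝ V] {B : LinearMap.BilinForm ℝ V}

section SimpleSystem

variable {Δ : ι → V}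

theorem bilin_simple_nonpos (hΔ : IsSimpleSystem B Δ) {i j : ι} (h : i ≠ j) :
    B (Δ i) (Δ j) ≤ 0 := by
  rcases hΔ.off_diag i j h with hle | ⟨k, hk, heq⟩
  · exact hle.trans (by norm_num)
  · have hk' : (2 : ℝ) ≤ k := by exact_mod_cast hk
    have hangle : Real.pi / k ≤ Real.pi / 2 := by gcongr
    have hangle0 : 0 ≤ Real.pi / k := by positivity
    rw [heq, neg_nonpos]
    exact Real.cos_nonneg_of_neg_pi_div_two_le_of_le (by linarith [Real.pi_pos]) hangle

theorem bilin_sum_abs_smul_simple_le (hΔ : IsSimpleSystem B Δ) (c : ι → ℝ) :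
    B (∑ i, |c i| • Δ i) (∑ i, |c i| • Δ i) ≤ B (∑ i, c i • Δ i) (∑ i, c i • Δ i) := by
  simp only [map_sum, map_smul, LinearMap.sum_apply, LinearMap.smul_apply, smul_eq_mul,
    Finset.mul_sum, ← mul_assoc]
  refine Finset.sum_le_sum fun i _ => Finset.sum_le_sum fun j _ => ?_
  rcases eq_or_ne j i with rfl | hne
  · rw [abs_mul_abs_self]
  · rw [← abs_mul]
    exact mul_le_mul_of_nonpos_right (le_abs_self _) (bilin_simple_nonpos hΔ hne)

theorem apply_mem_span_simple_iff (hΔ : IsSimpleSystem B Δ) {J : Set ι}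
    (hJ : ∀ i ∈ J, ∀ j ∉ J, B (Δ i) (Δ j) = 0) {w : V ≃ₗ[ℝ] V} (hw : w ∈ weylGroup B Δ) (v : V) :
    w v ∈ Submodule.span ℝ (Δ '' J) ↔ v ∈ Submodule.span ℝ (Δ '' J) := by
  induction hw using Subgroup.closure_induction generalizing v with
  | mem w hw =>
    obtain ⟨i, rfl⟩ := hw
    have hmaps {u : V} (hu : u ∈ Submodule.span ℝ (Δ '' J)) :
        reflection B (Δ i) u ∈ Submodule.span ℝ (Δ '' J) := by
      rw [reflection_apply (hΔ.diag i)]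
      by_cases hi : i ∈ J
      · exact sub_mem hu (Submodule.smul_mem _ _ (Submodule.subset_span ⟨i, hi, rfl⟩))
      · rwa [bilin_simple_eq_zero_of_mem_span hΔ.isSymm hJ hi hu, mul_zero, zero_smul, sub_zero]
    exact ⟨fun h => reflection_reflection (B := B) (Δ i) v ▸ hmaps h, hmaps⟩
  | one => rfl
  | mul w w' _ _ hw hw' => exact (hw _).trans (hw' v)
  | inv w _ hw => rw [← hw, show w (w⁻¹ v) = v from w.apply_symm_apply v]

theorem root_mem_span_simple_or_compl (hΔ : IsSimpleSystem B Δ) {J : Set ι}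
    (hJ : ∀ i ∈ J, ∀ j ∉ J, B (Δ i) (Δ j) = 0) {ρ : V} (hρ : ρ ∈ roots B Δ) :
    ρ ∈ Submodule.span ℝ (Δ '' J) ∨ ρ ∈ Submodule.span ℝ (Δ '' Jᶜ) := by
  obtain ⟨w, hw, i, rfl⟩ := hρ
  refine (em (i ∈ J)).imp (fun hi => ?_) fun hi => ?_
  · exact (apply_mem_span_simple_iff hΔ hJ hw _).2 (Submodule.subset_span ⟨i, hi, rfl⟩)
  · refine (apply_mem_span_simple_iff hΔ (fun k hk j hj => ?_) hw _).2
      (Submodule.subset_span ⟨i, hi, rfl⟩)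
    rw [hΔ.symm, hJ j (not_not.1 hj) k hk]

end SimpleSystem

section Basis

variable {Δ : Module.Basis ι ℝ V}

theorem bilin_simple_eq_zero_of_radical (hΔ : IsSimpleSystem B Δ) {x : V} (hx : x ∈ cone Δ)
    (hrad : ∀ i, B (Δ i) x = 0) {i j : ι} (hi : Δ.repr x i ≠ 0) (hj : Δ.repr x j = 0) :
    B (Δ i) (Δ j) = 0 := by
  have hsum : ∑ k, Δ.repr x k * B (Δ j) (Δ k) = 0 := by
    simpa only [map_sum, map_smul, smul_eq_mul] using (congrArg (B (Δ j)) (Δ.sum_repr x)).trans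
      (hrad j)
  rw [Finset.sum_eq_zero_iff_of_nonpos] at hsum
  · rw [hΔ.symm]
    exact (mul_eq_zero.1 (hsum i (Finset.mem_univ i))).resolve_left hi
  · intro k _
    rcases eq_or_ne j k with rfl | hne
    · rw [hj, zero_mul]
    · exact mul_nonpos_of_nonneg_of_nonpos (mem_cone_iff.1 hx k) (bilin_simple_nonpos hΔ hne)

theorem bilin_self_nonneg_of_radical (hΔ : IsSimpleSystem B Δ) {x : V} (hx : x ∈ cone Δ)
    (hrad : ∀ i, B (Δ i) x = 0) {v : V}
    (hv : v ∈ Submodule.span ℝ (Δ '' {i | Δ.repr x i ≠ 0})) : 0 ≤ B v v := by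
  set e : ι → V := fun i => Δ.repr x i • Δ i
  have hsum : ∑ i, e i = x := Δ.sum_repr x
  have hve : v = ∑ i, (Δ.repr v i / Δ.repr x i) • e i := by
    nth_rw 1 [← Δ.sum_repr v]
    refine Finset.sum_congr rfl fun i _ => ?_
    rw [smul_smul, div_mul_cancel_of_imp fun hi => mem_span_simple_iff.1 hv i fun h => h hi]
  rw [hve, bilin_sum_smul_self_of_forall_bilin_sum_eq_zero hΔ.isSymm fun i => by
    rw [hsum, map_smul, LinearMap.smul_apply, hrad, smul_zero]]
  refine mul_nonneg_of_nonpos_of_nonpos (by norm_num) ?_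
  refine Finset.sum_nonpos fun i _ => Finset.sum_nonpos fun j _ => ?_
  rcases eq_or_ne i j with rfl | hne
  · simp
  · simp only [e, map_smul, LinearMap.smul_apply, smul_eq_mul]
    have hprod := mul_nonneg (mem_cone_iff.1 hx i) (mem_cone_iff.1 hx j)
    nlinarith [mul_nonneg hprod (neg_nonneg.2 (bilin_simple_nonpos hΔ hne)),
      sq_nonneg (Δ.repr v i / Δ.repr x i - Δ.repr v j / Δ.repr x j)]

theorem isSemidefiniteComponent_support_of_radical (hΔ : IsSimpleSystem B Δ) {x : V}
    (hx : x ∈ cone Δ) (hrad : ∀ i, B (Δ i) x = 0) :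
    IsSemidefiniteComponent B Δ {i | Δ.repr x i ≠ 0} where
  orthogonal _ hi _ hj := bilin_simple_eq_zero_of_radical hΔ hx hrad hi (not_not.1 hj)
  nonneg _ hv := bilin_self_nonneg_of_radical hΔ hx hrad hv

section Dominance

/-- The positive roots of the standard parabolic subsystem of `J` at which the linear form `f` is
negative. Their number measures how far `f` is from being dominant with respect to `J`. -/
def negativePosRoots (B : LinearMap.BilinForm ℝ V) (Δ : Module.Basis ι ℝ V) (J : Set ι)
    (f : V →ₗ[ℝ] ℝ) : Set V :=
  {σ | σ ∈ posRoots B Δ ∧ σ ∈ Submodule.span ℝ (Δ '' J) ∧ f σ < 0}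

theorem negativePosRoots_comp_simpleReflection_subset (hΔ : IsSimpleSystem B Δ) {J : Set ι}
    {i : ι} (hi : i ∈ J) {f : V →ₗ[ℝ] ℝ} (hf : f (Δ i) < 0) :
    negativePosRoots B Δ J (f ∘ₗ (simpleReflection B Δ i).toLinearMap) ⊆
      simpleReflection B Δ i '' (negativePosRoots B Δ J f \ {Δ i}) := by
  rintro σ ⟨hσ, hσJ, hfσ : f (simpleReflection B Δ i σ) < 0⟩
  have hne : σ ≠ Δ i := by
    rintro rfl
    rw [reflection_self (hΔ.diag i), map_neg] at hfσ
    linarith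
  have hpos := simpleReflection_mem_posRoots hΔ hσ hne
  refine ⟨simpleReflection B Δ i σ, ⟨⟨hpos, ?_, hfσ⟩, fun h => ?_⟩, reflection_reflection _ _⟩
  · rw [reflection_apply (hΔ.diag i)]
    exact sub_mem hσJ (Submodule.smul_mem _ _ (Submodule.subset_span ⟨i, hi, rfl⟩))
  · have hneg : σ = -Δ i := by
      rw [← reflection_reflection (B := B) (Δ i) σ, Set.mem_singleton_iff.1 h,
        reflection_self (hΔ.diag i)]
    have hsum := sumCoords_pos hΔ hσ
    rw [hneg, map_neg, Δ.sumCoords_self_apply] at hsum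
    linarith

theorem exists_forall_nonneg_apply_simple (hΔ : IsSimpleSystem B Δ) {J : Set ι}
    {f : V →ₗ[ℝ] ℝ} (hfin : (negativePosRoots B Δ J f).Finite) :
    ∃ w ∈ Subgroup.closure (reflection B '' (Δ '' J)), ∀ j ∈ J, 0 ≤ f (w (Δ j)) := by
  induction hn : (negativePosRoots B Δ J f).ncard using Nat.strong_induction_on
    generalizing f with
  | _ n ih =>
  by_cases hdom : ∀ j ∈ J, 0 ≤ f (Δ j)
  · exact ⟨1, one_mem _, hdom⟩
  push Not at hdom
  obtain ⟨i, hi, hneg⟩ := hdom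
  have hsub := negativePosRoots_comp_simpleReflection_subset hΔ hi hneg
  have himage := (hfin.sdiff (t := {Δ i})).image (simpleReflection B Δ i)
  have hlt := calc
    _ ≤ _ := Set.ncard_le_ncard hsub himage
    _ ≤ _ := Set.ncard_image_le hfin.sdiff
    _ < (negativePosRoots B Δ J f).ncard := Set.ncard_sdiff_singleton_lt_of_mem
      ⟨simple_mem_posRoots i, Submodule.subset_span ⟨i, hi, rfl⟩, hneg⟩ hfin
  obtain ⟨w, hw, hdom⟩ := ih _ (hn ▸ hlt) (himage.subset hsub) rfl
  exact ⟨simpleReflection B Δ i * w,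
    mul_mem (Subgroup.subset_closure ⟨Δ i, ⟨i, hi, rfl⟩, rfl⟩) hw, hdom⟩

end Dominance

section LevelForm

variable {J : Set ι} {f : V →ₗ[ℝ] ℝ}

theorem mem_span_simple_of_apply_eq_zero (hΔ : IsSimpleSystem B Δ)
    (hf : ∀ j ∈ J, 0 ≤ f (Δ j)) {ρ : V} (hρ : ρ ∈ roots B Δ)
    (hρJ : ρ ∈ Submodule.span ℝ (Δ '' J)) (hfρ : f ρ = 0) :
    ρ ∈ Submodule.span ℝ (Δ '' {j ∈ J | f (Δ j) = 0}) := by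
  wlog hpos : ρ ∈ posRoots B Δ generalizing ρ
  · exact neg_mem_iff.1 (this (neg_mem_roots hΔ hρ) (neg_mem hρJ) (by rw [map_neg, hfρ, neg_zero])
      ((mem_or_neg_mem_posRoots hΔ hρ).resolve_left hpos))
  have hsum : ∑ j, Δ.repr ρ j * f (Δ j) = 0 := by
    simpa only [map_sum, map_smul, smul_eq_mul] using (congrArg f (Δ.sum_repr ρ)).trans hfρ
  rw [Finset.sum_eq_zero_iff_of_nonneg] at hsum
  · refine mem_span_simple_iff.2 fun j hj => ?_
    by_cases hjJ : j ∈ J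
    · exact (mul_eq_zero.1 (hsum j (Finset.mem_univ j))).resolve_right fun h => hj ⟨hjJ, h⟩
    · exact mem_span_simple_iff.1 hρJ j hjJ
  · intro j _
    by_cases hjJ : j ∈ J
    · exact mul_nonneg (mem_cone_iff.1 hpos.2 j) (hf j hjJ)
    · rw [mem_span_simple_iff.1 hρJ j hjJ, zero_mul]

theorem eq_zero_of_isotropic_of_apply_eq_sumCoords (hΔ : IsSimpleSystem B Δ)
    (hJ : ∀ v ∈ Submodule.span ℝ (Δ '' J), 0 ≤ B v v)
    (hf : ∀ r ∈ Submodule.span ℝ (Δ '' J), B r r = 0 → f r = Δ.sumCoords r) {v : V}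
    (hv : v ∈ Submodule.span ℝ (Δ '' {j ∈ J | f (Δ j) = 0})) (hBv : B v v = 0) : v = 0 := by
  set u : V := ∑ i, |Δ.repr v i| • Δ i
  have hu (i : ι) : Δ.repr u i = |Δ.repr v i| := by rw [Δ.repr_sum_self]
  have huK : u ∈ Submodule.span ℝ (Δ '' {j ∈ J | f (Δ j) = 0}) :=
    mem_span_simple_iff.2 fun i hi => by rw [hu, mem_span_simple_iff.1 hv i hi, abs_zero]
  have huJ : u ∈ Submodule.span ℝ (Δ '' J) :=
    Submodule.span_mono (Set.image_mono fun _ hj => hj.1) huK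
  have hBu : B u u = 0 := by
    have hle := bilin_sum_abs_smul_simple_le hΔ (Δ.repr v)
    rw [Δ.sum_repr, hBv] at hle
    exact le_antisymm hle (hJ u huJ)
  have hfu : u ∈ f.ker := by
    refine Submodule.span_le.2 ?_ huK
    rintro _ ⟨j, hj, rfl⟩
    exact hj.2
  have hu0 : u = 0 := eq_zero_of_sumCoords_eq_zero
    (mem_cone_iff.2 fun i => (hu i).symm ▸ abs_nonneg _) ((hf u huJ hBu).symm.trans hfu)
  exact Δ.ext_elem fun i => by
    rw [map_zero, Finsupp.zero_apply, ← abs_eq_zero, ← hu, hu0, map_zero, Finsupp.zero_apply]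

end LevelForm

end Basis

end SemidefiniteComponent

section Density

open Filter Topology

variable {ι V : Type*} [Fintype ι] [NormedAddCommGroup V] [NormedSpace ℝ V]
  {B : LinearMap.BilinForm ℝ V} {Δ : Module.Basis ι ℝ V}

section LineThroughRoots

theorem eventually_ne_normalizeVec (hΔ : IsSimpleSystem B Δ) {x η : V} (hx : B x x = 0)
    (hη : η ∈ roots B Δ) : ∀ᶠ v in 𝓝 x, v ≠ normalizeVec Δ η := by
  refine eventually_ne_nhds ?_
  rintro rfl
  rw [bilin_normalizeVec_self hΔ hη] at hx
  exact pow_ne_zero 2 (inv_ne_zero (sumCoords_ne_zero hΔ hη)) hx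

/-- As `v` tends to `x` through normalized roots, the points `v + s v • η`, once normalized, lie on
lines through two roots and tend to `x`. -/
theorem mem_closure_isotropicLinePoints (hΔ : IsSimpleSystem B Δ) {A : Set V}
    (hA : A ⊆ posRoots B Δ) {x : V} (hx : x ∈ limitSet Δ A) {η : V} (hη : η ∈ posRoots B Δ)
    {s : V → ℝ} (hs : ContinuousAt s x) (hs0 : s x = 0)
    (hB : ∀ᶠ v in 𝓝 x, v ∈ normalizeVec Δ '' A → B (v + s v • η) (v + s v • η) = 0) :
    x ∈ closure (isotropicLinePoints B Δ) := by
  have : FiniteDimensional ℝ V := Module.Finite.of_basis Δ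
  have hlimit := limitSet_mono (hA.trans Set.inter_subset_left) hx
  have hx1 : Δ.sumCoords x = 1 := sumCoords_eq_one_of_mem_limitRoots hΔ hlimit
  have hsx : x + s x • η = x := by rw [hs0, zero_smul, add_zero]
  have hadd : ContinuousAt (fun v => v + s v • η) x :=
    continuousAt_id.add (hs.smul continuousAt_const)
  have hsum : ContinuousAt (fun v => Δ.sumCoords (v + s v • η)) x :=
    (continuous_sumCoords Δ).continuousAt.comp (f := fun v => v + s v • η) hadd
  have hsum0 : Δ.sumCoords (x + s x • η) ≠ 0 := by rw [hsx, hx1]; exact one_ne_zero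
  have hnorm : Tendsto (fun v => normalizeVec Δ (v + s v • η)) (𝓝 x) (𝓝 x) := by
    have hcont : ContinuousAt (fun v => (Δ.sumCoords (v + s v • η))⁻¹ • (v + s v • η)) x :=
      (hsum.inv₀ hsum0).smul hadd
    simpa only [normalizeVec_eq_smul, hsx, hx1, inv_one, one_smul] using hcont.tendsto
  have hne := eventually_ne_normalizeVec hΔ
    (limitRoots_subset_normalizedIsotropicCone hΔ hlimit).1 hη.1
  refine mem_closure_iff_frequently.2 (hnorm.frequently
    (((accPt_iff_frequently.1 hx).and_eventually
      (hB.and (hne.and (hsum.eventually_ne hsum0)))).mono ?_))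
  rintro _ ⟨⟨-, ρ, hρ, rfl⟩, hBρ, hρη, hρ0⟩
  exact normalizeVec_add_smul_mem_isotropicLinePoints hΔ (hA hρ) hη
    (fun h => hρη (congrArg _ h)) (hBρ ⟨ρ, hρ, rfl⟩) hρ0

/-- Near `x` the line through `v` in the direction of `Δ i` meets the isotropic cone in two points,
one of which tends to `x`; which one depends on the sign of `B (Δ i) x`. -/
theorem mem_closure_of_bilin_simple_ne_zero (hΔ : IsSimpleSystem B Δ) {x : V}
    (hx : x ∈ limitRoots B Δ) {i : ι} (hi : B (Δ i) x ≠ 0) :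
    x ∈ closure (isotropicLinePoints B Δ) := by
  have : FiniteDimensional ℝ V := Module.Finite.of_basis Δ
  have hBx := (limitRoots_subset_normalizedIsotropicCone hΔ hx).1
  set b := B (Δ i) x
  have hcoord : Continuous fun v => B (Δ i) v := (B (Δ i)).continuous_of_finiteDimensional
  have hdisc : Continuous fun v => B (Δ i) v ^ 2 - B v v :=
    (hcoord.pow 2).sub (continuous_bilin_self B)
  have hdiscx : B (Δ i) x ^ 2 - B x x = b ^ 2 := by rw [hBx, sub_zero]
  have hpos : ∀ᶠ v in 𝓝 x, 0 < B (Δ i) v ^ 2 - B v v :=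
    hdisc.continuousAt.eventually_const_lt (hdiscx.ge.trans_lt' (sq_pos_iff.2 hi))
  have hsign : (b / |b|) ^ 2 = 1 := by rw [div_pow, sq_abs, div_self (pow_ne_zero 2 hi)]
  refine mem_closure_isotropicLinePoints hΔ subset_rfl ((limitSet_posRoots hΔ).ge hx)
    (simple_mem_posRoots i) (s := fun v => -B (Δ i) v + b / |b| * √(B (Δ i) v ^ 2 - B v v))
    (hcoord.neg.add (continuous_const.mul hdisc.sqrt)).continuousAt ?_ (hpos.mono fun v hv _ => ?_)
  · rw [hdiscx, Real.sqrt_sq_eq_abs, div_mul_cancel₀ _ (abs_ne_zero.2 hi), neg_add_cancel]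
  · simp only [map_add, map_smul, LinearMap.add_apply, LinearMap.smul_apply, smul_eq_mul,
      hΔ.diag, hΔ.symm v (Δ i)]
    linear_combination Real.sq_sqrt hv.le + √(B (Δ i) v ^ 2 - B v v) ^ 2 * hsign

end LineThroughRoots

section AnisotropicRoots

theorem finite_roots_inter_of_anisotropic (hΔ : IsSimpleSystem B Δ) {U : Submodule ℝ V}
    (hU : ∀ v ∈ U, B v v = 0 → v = 0) : (roots B Δ ∩ U).Finite := by
  by_contra hinf
  have : FiniteDimensional ℝ V := Module.Finite.of_basis Δ
  obtain ⟨z, hz⟩ := limitSet_nonempty hΔ Set.inter_subset_left hinf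
  have hzU : z ∈ U := by
    refine closure_minimal ?_ (Submodule.closed_of_finiteDimensional U)
      (derivedSet_subset_closure _ hz)
    rintro _ ⟨τ, hτ, rfl⟩
    rw [normalizeVec_eq_smul]
    exact Submodule.smul_mem _ _ hτ.2
  have hzlimit := limitSet_mono Set.inter_subset_left hz
  have hz1 := sumCoords_eq_one_of_mem_limitRoots hΔ hzlimit
  rw [hU z hzU (limitRoots_subset_normalizedIsotropicCone hΔ hzlimit).1, map_zero] at hz1
  exact zero_ne_one hz1

/-- The roots lying in the span of a set of simple roots on which `B` has no nonzero isotropic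
vector. There are finitely many of them, and every value `B ρ σ ≠ ±1` on two roots of a semidefinite
component is attained by two of them. -/
def anisotropicRoots {ι V : Type*} [AddCommGroup V] [Module ℝ V]
    (B : LinearMap.BilinForm ℝ V) (Δ : ι → V) : Set V :=
  {ρ | ρ ∈ roots B Δ ∧ ∃ J : Set ι, (∀ v ∈ Submodule.span ℝ (Δ '' J), B v v = 0 → v = 0) ∧
    ρ ∈ Submodule.span ℝ (Δ '' J)}

theorem finite_anisotropicRoots (hΔ : IsSimpleSystem B Δ) : (anisotropicRoots B Δ).Finite := by
  refine (Set.finite_iUnion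
    (ι := {J : Set ι // ∀ v ∈ Submodule.span ℝ (Δ '' J), B v v = 0 → v = 0})
    fun J => finite_roots_inter_of_anisotropic hΔ J.2).subset ?_
  rintro ρ ⟨hρ, J, hJ, hρJ⟩
  exact Set.mem_iUnion.2 ⟨⟨J, hJ⟩, hρ, hρJ⟩

theorem finite_negativePosRoots_sumCoords_sub (hΔ : IsSimpleSystem B Δ) {J : Set ι}
    (hJ : ∀ v ∈ Submodule.span ℝ (Δ '' J), 0 ≤ B v v) {p : V}
    (hp : p ∈ Submodule.span ℝ (Δ '' J)) :
    (negativePosRoots B Δ J (Δ.sumCoords - B p)).Finite := by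
  refine (finite_posRoots_sumCoords_le hΔ √(B p p)).subset ?_
  rintro τ ⟨hτ, hτJ, hneg⟩
  have hsq := sq_bilin_le_of_nonneg hΔ.isSymm hJ hp hτJ
  rw [bilin_root_self hΔ hτ.1, mul_one] at hsq
  exact ⟨hτ, (sub_neg.1 hneg).le.trans (Real.le_sqrt_of_sq_le hsq)⟩

/-- The form `Δ.sumCoords - B p`, with `p` chosen to make it vanish at `ρ` and `σ`, agrees with
`Δ.sumCoords` on isotropic vectors and is negative at finitely many positive roots only. Hence an
element of the parabolic subgroup of `J` makes it dominant, and then its kernel meets the roots of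
`J` in anisotropic roots. -/
theorem exists_anisotropicRoots_bilin_eq (hΔ : IsSimpleSystem B Δ) {J : Set ι}
    (hJ : ∀ v ∈ Submodule.span ℝ (Δ '' J), 0 ≤ B v v) {ρ σ : V} (hρ : ρ ∈ roots B Δ)
    (hρJ : ρ ∈ Submodule.span ℝ (Δ '' J)) (hσ : σ ∈ roots B Δ)
    (hσJ : σ ∈ Submodule.span ℝ (Δ '' J)) (hρσ : B ρ σ ^ 2 ≠ 1) :
    ∃ ρ' ∈ anisotropicRoots B Δ, ∃ σ' ∈ anisotropicRoots B Δ, B ρ' σ' = B ρ σ := by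
  obtain ⟨p, hp, hpρ, hpσ⟩ := exists_mem_span_pair_bilin_eq hΔ.isSymm (bilin_root_self hΔ hρ)
    (bilin_root_self hΔ hσ) hρσ (Δ.sumCoords ρ) (Δ.sumCoords σ)
  have hpJ : p ∈ Submodule.span ℝ (Δ '' J) := Submodule.span_le.2 (Set.pair_subset hρJ hσJ) hp
  obtain ⟨w, hw, hdom⟩ := exists_forall_nonneg_apply_simple hΔ
    (finite_negativePosRoots_sumCoords_sub hΔ hJ hpJ)
  set f : V →ₗ[ℝ] ℝ := (Δ.sumCoords - B p) ∘ₗ w.toLinearMap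
  have hf (v : V) : f v = Δ.sumCoords (w v) - B p (w v) := rfl
  have hlevel (r : V) (hr : r ∈ Submodule.span ℝ (Δ '' J)) (hBr : B r r = 0) :
      f r = Δ.sumCoords r := by
    have hfix : w r = r := apply_eq_self_of_mem_closure_reflection (fun α hα =>
      bilin_eq_zero_of_isotropic hΔ.isSymm hJ (Submodule.subset_span hα) hr hBr) hw
    rw [hf, hfix, bilin_eq_zero_of_isotropic hΔ.isSymm hJ hpJ hr hBr, sub_zero]
  have hwW : w⁻¹ ∈ weylGroup B Δ := by
    refine inv_mem (Subgroup.closure_mono ?_ hw)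
    rintro _ ⟨_, ⟨i, -, rfl⟩, rfl⟩
    exact ⟨i, rfl⟩
  have hmem {τ : V} (hτ : τ ∈ roots B Δ) (hτJ : τ ∈ Submodule.span ℝ (Δ '' J))
      (hpτ : B p τ = Δ.sumCoords τ) : w⁻¹ τ ∈ anisotropicRoots B Δ := by
    have hwτ := apply_mem_roots hwW hτ
    have hwτJ : w⁻¹ τ ∈ Submodule.span ℝ (Δ '' J) :=
      (Submodule.sub_mem_iff_left _ hτJ).1
        (sub_mem_span_of_mem_closure_reflection (inv_mem hw) τ)
    have hfτ : f (w⁻¹ τ) = 0 := by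
      rw [hf, show w (w⁻¹ τ) = τ from w.apply_symm_apply τ, hpτ, sub_self]
    exact ⟨hwτ, _, fun v => eq_zero_of_isotropic_of_apply_eq_sumCoords hΔ hJ hlevel,
      mem_span_simple_of_apply_eq_zero hΔ hdom hwτ hwτJ hfτ⟩
  exact ⟨_, hmem hρ hρJ hpρ, _, hmem hσ hσJ hpσ, weylGroup_isometry hΔ hwW ρ σ⟩

theorem finite_image2_bilin_roots (hΔ : IsSimpleSystem B Δ) {J : Set ι}
    (hJ : ∀ v ∈ Submodule.span ℝ (Δ '' J), 0 ≤ B v v) :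
    (Set.image2 (fun ρ σ => B ρ σ) (roots B Δ ∩ Submodule.span ℝ (Δ '' J))
      (roots B Δ ∩ Submodule.span ℝ (Δ '' J))).Finite := by
  have hfin := finite_anisotropicRoots hΔ
  refine ((Set.toFinite {1, -1}).union (hfin.image2 (fun ρ σ => B ρ σ) hfin)).subset ?_
  rintro _ ⟨ρ, hρ, σ, hσ, rfl⟩
  by_cases hsq : B ρ σ ^ 2 = 1
  · exact Or.inl (sq_eq_one_iff.1 hsq)
  · exact Or.inr (exists_anisotropicRoots_bilin_eq hΔ hJ hρ.1 hρ.2 hσ.1 hσ.2 hsq)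

theorem IsSemidefiniteComponent.finite_image_bilin_roots {J : Set ι}
    (hJ : IsSemidefiniteComponent B Δ J) (hΔ : IsSimpleSystem B Δ) :
    (B '' (roots B Δ ∩ Submodule.span ℝ (Δ '' J))).Finite := by
  have hinj : Function.Injective fun (f : V →ₗ[ℝ] ℝ) (i : ι) => f (Δ i) :=
    fun f g h => Δ.ext (congrFun h)
  refine Set.Finite.of_finite_image ?_ hinj.injOn
  refine (Set.Finite.pi' fun _ => (finite_image2_bilin_roots hΔ hJ.nonneg).insert 0).subset ?_
  rintro _ ⟨_, ⟨ρ, hρ, rfl⟩, rfl⟩ i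
  by_cases hi : i ∈ J
  · exact Or.inr ⟨ρ, hρ, Δ i, ⟨simple_mem_roots i, Submodule.subset_span ⟨i, hi, rfl⟩⟩, rfl⟩
  · left
    exact (hΔ.symm _ _).trans (bilin_simple_eq_zero_of_mem_span hΔ.isSymm hJ.orthogonal hi hρ.2)

end AnisotropicRoots

section Radical

theorem exists_mem_limitSet_fiber {κ : Type*} {g : V → κ} {A : Set V} (hfin : (g '' A).Finite)
    {x : V} (hx : x ∈ limitSet Δ A) : ∃ η ∈ A, x ∈ limitSet Δ {ρ ∈ A | g ρ = g η} := by
  have hfreq : ∃ᶠ v in 𝓝 x, ∃ k ∈ g '' A, v ≠ x ∧ v ∈ normalizeVec Δ '' {ρ ∈ A | g ρ = k} := by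
    refine (accPt_iff_frequently.1 hx).mono ?_
    rintro _ ⟨hne, ρ, hρ, rfl⟩
    exact ⟨g ρ, ⟨ρ, hρ, rfl⟩, hne, ρ, ⟨hρ, rfl⟩, rfl⟩
  obtain ⟨_, ⟨η, hη, rfl⟩, h⟩ := (frequently_exists_finite hfin).1 hfreq
  exact ⟨η, hη, accPt_iff_frequently.2 h⟩

theorem limitRoots_subset_cone (hΔ : IsSimpleSystem B Δ) : limitRoots B Δ ⊆ cone Δ := by
  have : FiniteDimensional ℝ V := Module.Finite.of_basis Δ
  intro x hx
  refine mem_cone_iff.2 fun i => ?_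
  refine closure_minimal (t := {v | 0 ≤ Δ.repr v i}) ?_ (isClosed_le continuous_const
    (Δ.coord i).continuous_of_finiteDimensional)
    (derivedSet_subset_closure _ ((limitSet_posRoots hΔ).ge hx))
  rintro _ ⟨ρ, hρ, rfl⟩
  refine mem_cone_iff.1 ?_ i
  rw [normalizeVec_eq_smul]
  exact smul_mem_cone (inv_nonneg.2 (sumCoords_pos hΔ hρ).le) hρ.2

theorem mem_limitSet_span_support (hΔ : IsSimpleSystem B Δ) {x : V} (hx : x ∈ limitRoots B Δ)
    (hJ : IsSemidefiniteComponent B Δ {i | Δ.repr x i ≠ 0}) :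
    x ∈ limitSet Δ (posRoots B Δ ∩ Submodule.span ℝ (Δ '' {i | Δ.repr x i ≠ 0})) := by
  have : FiniteDimensional ℝ V := Module.Finite.of_basis Δ
  obtain ⟨i, hi⟩ : ∃ i, Δ.repr x i ≠ 0 := by
    by_contra! h
    have hx1 := sumCoords_eq_one_of_mem_limitRoots hΔ hx
    rw [sumCoords_apply, Finset.sum_eq_zero fun i _ => h i] at hx1
    exact zero_ne_one hx1
  have hnhds : {v | Δ.repr v i ≠ 0} ∈ 𝓝 x :=
    (Δ.coord i).continuous_of_finiteDimensional.continuousAt.eventually_ne hi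
  refine AccPt.mono (AccPt.nhds_inter ((limitSet_posRoots hΔ).ge hx) hnhds)
    (principal_mono.2 ?_)
  rintro _ ⟨hρi, ρ, hρ, rfl⟩
  refine ⟨ρ, ⟨hρ, ?_⟩, rfl⟩
  refine (root_mem_span_simple_or_compl hΔ hJ.orthogonal hρ.1).resolve_right fun h => hρi ?_
  rw [normalizeVec_eq_smul, map_smul, Finsupp.smul_apply,
    mem_span_simple_iff.1 h i (not_not.2 hi), smul_zero]

/-- Infinitely many roots `ρ` near the ray of `x` define the same functional `B ρ`; the difference
of two of them is isotropic. -/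
theorem mem_closure_of_forall_bilin_simple_eq_zero (hΔ : IsSimpleSystem B Δ) {x : V}
    (hx : x ∈ limitRoots B Δ) (hrad : ∀ i, B (Δ i) x = 0) :
    x ∈ closure (isotropicLinePoints B Δ) := by
  have : FiniteDimensional ℝ V := Module.Finite.of_basis Δ
  have hJ := isSemidefiniteComponent_support_of_radical hΔ (limitRoots_subset_cone hΔ hx) hrad
  obtain ⟨η, hη, hxη⟩ := exists_mem_limitSet_fiber
    ((hJ.finite_image_bilin_roots hΔ).subset
      (Set.image_mono (Set.inter_subset_inter_left _ Set.inter_subset_left)))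
    (mem_limitSet_span_support hΔ hx hJ)
  refine mem_closure_isotropicLinePoints hΔ (fun ρ hρ => hρ.1.1) hxη hη.1
    (s := fun v => -√(B v v)) (continuous_bilin_self B).sqrt.neg.continuousAt ?_
    (Eventually.of_forall ?_)
  · rw [(limitRoots_subset_normalizedIsotropicCone hΔ hx).1, Real.sqrt_zero, neg_zero]
  · rintro _ ⟨ρ, ⟨⟨hρ, -⟩, hρη⟩, rfl⟩
    have hdiff : normalizeVec Δ ρ + -√(B (normalizeVec Δ ρ) (normalizeVec Δ ρ)) • η =
        (Δ.sumCoords ρ)⁻¹ • (ρ - η) := by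
      rw [bilin_normalizeVec_self hΔ hρ.1, Real.sqrt_sq (inv_nonneg.2 (sumCoords_pos hΔ hρ).le),
        normalizeVec_eq_smul]
      module
    have hker : B (ρ - η) = 0 := by rw [map_sub, hρη, sub_self]
    simp only [hdiff, map_smul, hker, LinearMap.zero_apply, smul_zero]

end Radical

theorem limitRoots_subset_closure_isotropicLinePoints (hΔ : IsSimpleSystem B Δ) :
    limitRoots B Δ ⊆ closure (isotropicLinePoints B Δ) := by
  intro x hx
  by_cases hrad : ∀ i, B (Δ i) x = 0
  · exact mem_closure_of_forall_bilin_simple_eq_zero hΔ hx hrad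
  · push Not at hrad
    obtain ⟨i, hi⟩ := hrad
    exact mem_closure_of_bilin_simple_ne_zero hΔ hx hi

end Density

end BasedRoot

theorem mainTheorem3 {ι V : Type*} [Fintype ι] [NormedAddCommGroup V] [NormedSpace ℝ V]
    (B : LinearMap.BilinForm ℝ V) (Δ : Module.Basis ι ℝ V)
    (hΔ : BasedRoot.IsSimpleSystem B Δ) (hΦ : (BasedRoot.roots B Δ).Infinite) :
    BasedRoot.dihedralLimitRoots B Δ = BasedRoot.isotropicLinePoints B Δ ∧
      BasedRoot.dihedralLimitRoots B Δ ⊆ BasedRoot.limitRoots B Δ ∧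
      BasedRoot.limitRoots B Δ ⊆ closure (BasedRoot.dihedralLimitRoots B Δ) ∧
      BasedRoot.limitRoots B Δ = closure (BasedRoot.dihedralLimitRoots B Δ) := by
  have hlines := BasedRoot.dihedralLimitRoots_eq_isotropicLinePoints hΔ
  have hsubset : BasedRoot.dihedralLimitRoots B Δ ⊆ BasedRoot.limitRoots B Δ :=
    BasedRoot.dihedralLimitRoots_subset_limitRoots
  have hdense : BasedRoot.limitRoots B Δ ⊆ closure (BasedRoot.dihedralLimitRoots B Δ) := by
    rw [hlines]
    exact BasedRoot.limitRoots_subset_closure_isotropicLinePoints hΔ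
  exact ⟨hlines, hsubset, hdense,
    hdense.antisymm (closure_minimal hsubset (isClosed_derivedSet _))⟩
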